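/- **Conventions.** Let $X$ be a measurable space with countably generated $\sigma$-algebra (e.g. $\mathbb{R}^d$) and $\nu$ a reference measure on $X$ (e.g. Lebesgue measure). A *distribution* is a probability measure on $X$ that is absolutely continuous with respect to $\nu$, and $d_{\mathrm{TV}}(p,q)=\sup_S|p(S)-q(S)|$. A randomized algorithm assigns to each dataset $D\in X^n$, $n\ge 0$, a random output, measurably in $D$ (a Markov kernel). It is $(\varepsilon,\delta)$-DP if $\Pr[T(D)\in S]\le e^{\varepsilon}\Pr[T(D')\in S]+\delta$ for all $n$, all $D,D'\in X^n$ that differ in at most one entry, and all measurable $S$. For a class $\mathcal F$ of distributions, $k\text{-mix}(\mathcal F)=\{\sum_{i=1}^k w_if_i : w_i\ge 0,\ \sum_i w_i=1,\ f_i\in\mathcal F\}$, and $\mathcal H_\gamma(f)$ is the set of distributions of the form $(1-\gamma)f+\gamma h$ with $h$ an arbitrary distribution. An $(\varepsilon,\delta)$-DP *$L$-list-decodable learner* for $\mathcal F$ using $m_{\mathrm{List}}(\alpha,\beta,\gamma)\in\mathbb N$ samples is an algorithm, with parameters $\alpha,\beta,\gamma\in(0,1)$, that is $(\varepsilon,\delta)$-DP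 for all parameter values and such that, for all $f\in\mathcal F$, $g\in\mathcal H_\gamma(f)$ and $n\ge m_{\mathrm{List}}(\alpha,\beta,\gamma)$, on $n$ i.i.d. samples from $g$ it outputs a list of at most $L=L(\alpha,\beta,\gamma)$ distributions which with probability at least $1-\beta$ contains some $\tilde f$ with $d_{\mathrm{TV}}(f,\tilde f)\le\alpha$. An $(\varepsilon,\delta)$-DP *PAC learner* for $\mathcal F$ using $m(\alpha,\beta)$ samples is an algorithm, with parameters $\alpha,\beta\in(0,1)$, that is $(\varepsilon,\delta)$-DP for all parameter values and such that, for all $f\in\mathcal F$ and $n\ge m(\alpha,\beta)$, on $n$ i.i.d. samples from $f$ it outputs a distribution $\hat f$ with $d_{\mathrm{TV}}(f,\hat f)\le\alpha$ with probability at least $1-\beta$. **Theorem.** There is a universal constant $C>0$ such that the following holds. Let $\mathcal F$ be a nonempty class of distributions, $k\ge1$ an integer, $\varepsilon>0$ and $\delta\ge0$. If $\mathcal F$ has an $(\varepsilon,\delta)$-DP $L$-list-decodable learner using $m_{\mathrm{List}}(\alpha,\beta,\gamma)$ samples, then $k\text{-mix}(\mathcal F)$ has an $(\varepsilon,\delta)$-DP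 PAC learner using $$m(\alpha,\beta)=m_{\mathrm{List}}\!\left(\tfrac{\alpha}{18},\tfrac{\beta}{2k},1-\tfrac{\alpha}{18k}\right)+\left\lceil C\left(k\log\frac{L_0k}{\alpha}+\log\frac1\beta\right)\left(\frac1{\alpha^2}+\frac1{\alpha\varepsilon}\right)\right\rceil$$ samples, where $L_0=L\!\left(\tfrac{\alpha}{18},\tfrac{\beta}{2k},1-\tfrac{\alpha}{18k}\right)$. -/

import Mathlib

open MeasureTheory ProbabilityTheory
open scoped NNReal ENNReal

/-- Distributions on `X`: probability measures absolutely continuous with respect to the reference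
measure `ν`.  With `X = ℝᵈ` and `ν` Lebesgue measure these are the distributions with a density;
with `ν = Measure.count` the second condition is void and these are all probability measures. -/
def Distr {X : Type*} [MeasurableSpace X] (ν : Measure X) : Type _ :=
  {p : Measure X // IsProbabilityMeasure p ∧ p ≪ ν}

namespace Distr

variable {X : Type*} [MeasurableSpace X] {ν : Measure X}

/-- The σ-algebra generated by the evaluations `p ↦ p S`, `S` measurable. -/
instance : MeasurableSpace (Distr ν) :=
  inferInstanceAs (MeasurableSpace {p : Measure X // IsProbabilityMeasure p ∧ p ≪ ν})

/-- The underlying measure of a distribution. -/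
def toMeasure (p : Distr ν) : Measure X := p.1

instance (p : Distr ν) : IsProbabilityMeasure p.toMeasure := p.2.1

/-- Total variation distance: the supremum of `|p S - q S|` over measurable `S`. -/
noncomputable def tv (p q : Distr ν) : ℝ :=
  ⨆ S : {S : Set X // MeasurableSet S}, |p.toMeasure.real S.1 - q.toMeasure.real S.1|

/-- The `γ`-corrupted distributions of `f`: those of the form `(1 - γ) f + γ h`. -/
def corrupted (γ : ℝ) (f : Distr ν) : Set (Distr ν) :=
  {g | ∃ h : Distr ν, g.toMeasure =
    ENNReal.ofReal (1 - γ) • f.toMeasure + ENNReal.ofReal γ • h.toMeasure}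

/-- The class of `k`-mixtures of members of `F`. -/
def kMix (k : ℕ) (F : Set (Distr ν)) : Set (Distr ν) :=
  {g | ∃ w ∈ stdSimplex ℝ (Fin k), ∃ f : Fin k → Distr ν, (∀ i, f i ∈ F) ∧
    g.toMeasure = ∑ i, ENNReal.ofReal (w i) • (f i).toMeasure}

end Distr

/-- Finite lists of distributions, `⟨m, l⟩` being a list of length `m`; they carry the σ-algebra of
the disjoint union over `m` of the `m`-fold products. -/
abbrev DistrList {X : Type*} [MeasurableSpace X] (ν : Measure X) : Type _ :=
  Σ m : ℕ, Fin m → Distr ν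

/-- A randomized algorithm taking datasets over `X` of arbitrary size to outputs in `Y`: for every
size `n`, a Markov kernel from `Xⁿ` to `Y`. -/
structure RandAlg (X Y : Type*) [MeasurableSpace X] [MeasurableSpace Y] where
  /-- The output law on each dataset. -/
  run : ∀ n : ℕ, Kernel (Fin n → X) Y
  markov : ∀ n, IsMarkovKernel (run n)

namespace RandAlg

/-- The law of the output on `n` i.i.d. samples from `g`. -/
noncomputable def outputLaw {X Y : Type*} [MeasurableSpace X] [MeasurableSpace Y]
    (T : RandAlg X Y) (n : ℕ) (g : Measure X) : Measure Y :=
  (Measure.pi fun _ : Fin n => g).bind (T.run n)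

/-- `(ε, δ)`-differential privacy; datasets are neighbours if they differ in at most one entry. -/
def IsDP {X Y : Type*} [MeasurableSpace X] [MeasurableSpace Y]
    (ε δ : ℝ) (T : RandAlg X Y) : Prop :=
  ∀ (n : ℕ) (D D' : Fin n → X), {i | D i ≠ D' i}.Subsingleton →
    ∀ S : Set Y, MeasurableSet S →
      T.run n D S ≤ ENNReal.ofReal (Real.exp ε) * T.run n D' S + ENNReal.ofReal δ

end RandAlg

section Learners

variable {X : Type*} [MeasurableSpace X] {ν : Measure X}

/-- `A`, whose arguments are the parameters `α β`, is a PAC learner for `F` using `m` samples. -/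
def IsPACLearner (m : ℝ → ℝ → ℕ) (F : Set (Distr ν)) (A : ℝ → ℝ → RandAlg X (Distr ν)) : Prop :=
  ∀ α ∈ Set.Ioo (0 : ℝ) 1, ∀ β ∈ Set.Ioo (0 : ℝ) 1, ∀ f ∈ F, ∀ n ≥ m α β,
    ENNReal.ofReal (1 - β) ≤ (A α β).outputLaw n f.toMeasure {fhat | f.tv fhat ≤ α}

/-- `A`, whose arguments are the parameters `α β γ`, is an `L`-list-decodable learner for `F` using
`m` samples.  The list size `L` may depend on the parameters.  As lists are finite, a list is within
distance `α` of `f` exactly when one of its entries is. -/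
def IsListDecodableLearner (L m : ℝ → ℝ → ℝ → ℕ) (F : Set (Distr ν))
    (A : ℝ → ℝ → ℝ → RandAlg X (DistrList ν)) : Prop :=
  ∀ α ∈ Set.Ioo (0 : ℝ) 1, ∀ β ∈ Set.Ioo (0 : ℝ) 1, ∀ γ ∈ Set.Ioo (0 : ℝ) 1,
    ∀ f ∈ F, ∀ g ∈ f.corrupted γ, ∀ n ≥ m α β γ,
      (∀ᵐ l ∂(A α β γ).outputLaw n g.toMeasure, l.1 ≤ L α β γ) ∧
      ENNReal.ofReal (1 - β) ≤
        (A α β γ).outputLaw n g.toMeasure {l | ∃ i : Fin l.1, f.tv (l.2 i) ≤ α}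

/-- There is an `(ε, δ)`-DP PAC learner for `F` using `m` samples. -/
def HasDPPACLearner (ε δ : ℝ) (m : ℝ → ℝ → ℕ) (F : Set (Distr ν)) : Prop :=
  ∃ A : ℝ → ℝ → RandAlg X (Distr ν), IsPACLearner m F A ∧
    ∀ α ∈ Set.Ioo (0 : ℝ) 1, ∀ β ∈ Set.Ioo (0 : ℝ) 1, (A α β).IsDP ε δ

/-- There is an `(ε, δ)`-DP `L`-list-decodable learner for `F` using `m` samples. -/
def HasDPListDecodableLearner (ε δ : ℝ) (L m : ℝ → ℝ → ℝ → ℕ) (F : Set (Distr ν)) : Prop :=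
  ∃ A : ℝ → ℝ → ℝ → RandAlg X (DistrList ν), IsListDecodableLearner L m F A ∧
    ∀ α ∈ Set.Ioo (0 : ℝ) 1, ∀ β ∈ Set.Ioo (0 : ℝ) 1, ∀ γ ∈ Set.Ioo (0 : ℝ) 1,
      (A α β γ).IsDP ε δ

end Learners

/-!
The learner spends `mList` samples on the list-decodable learner and the others on selecting,
privately, among the mixtures that can be formed from its list.

A `k`-mixture `g` is a corruption, with `γ = 1 - α / (18 k)`, of each of its components of weight at
least `α / (18 k)` (`Distr.mix_mem_corrupted`).  By a union bound over the components, the list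
contains an approximation of all of these except with probability `β / 2`
(`IsListDecodableLearner.outputLaw_compl_le`).  The components of smaller weight contribute at most
`α / 18` to the total variation distance in total, and so does rounding the weights to multiples of
`1 / N` with `N = ⌈36 k / α⌉`.  Hence one of the at most `(L (N + 1)) ^ k` candidate mixtures is
within `α / 6` of `g` (`DistrList.exists_candidates_tv_le`).

The selection is the minimum distance estimator of Yatracos made private by the exponential
mechanism.  The score of a candidate is its largest discrepancy, in number of samples, between its
own prediction and the data on the Scheffé sets comparing it with the other candidates.  Changing
one sample changes a score by at most one, so drawing a candidate with probability proportional to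
`exp (-ε score / 2)` is `ε`-differentially private (`Distr.selectKernel_le_exp_mul`).  Hoeffding's
inequality bounds the error of the empirical frequencies by `α / 8`, and the mechanism loses at most
`α / 4` in score per sample, so that the output is within `3 (α / 6) + 2 (α / 8) + α / 4 = α` of
`g` (`Distr.score_add_le_score`, `Distr.lintegral_selectKernel_le`); both hold except with
probability `β / 2` for the stated number of samples (`selection_error_le`).

The two stages read disjoint parts of the dataset, so a change of one entry affects only one of
them, and the combination is `(ε, δ)`-differentially private (`twoStage_le`).  Everything is
measurable because the Scheffé sets are defined by a Radon–Nikodym derivative of kernels, which is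
jointly measurable as the σ-algebra of `X` is countably generated.
-/

/-! ### Distributions and the total variation distance -/

namespace Distr

section Basic

variable {X : Type*} [MeasurableSpace X] {ν : Measure X}

lemma measurable_toMeasure : Measurable (toMeasure : Distr ν → Measure X) :=
  measurable_subtype_coe

lemma abs_real_sub_le_one (p q : Distr ν) (S : Set X) :
    |p.toMeasure.real S - q.toMeasure.real S| ≤ 1 := by
  have h1 : p.toMeasure.real S ≤ 1 := measureReal_le_one
  have h2 : q.toMeasure.real S ≤ 1 := measureReal_le_one
  have h3 : 0 ≤ p.toMeasure.real S := measureReal_nonneg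
  have h4 : 0 ≤ q.toMeasure.real S := measureReal_nonneg
  exact abs_le.2 ⟨by linarith, by linarith⟩

lemma bddAbove_abs_sub (p q : Distr ν) :
    BddAbove (Set.range fun S : {S : Set X // MeasurableSet S} =>
      |p.toMeasure.real S.1 - q.toMeasure.real S.1|) :=
  ⟨1, Set.forall_mem_range.2 fun S => abs_real_sub_le_one p q S.1⟩

lemma abs_real_sub_le_tv (p q : Distr ν) {S : Set X} (hS : MeasurableSet S) :
    |p.toMeasure.real S - q.toMeasure.real S| ≤ p.tv q :=
  le_ciSup (bddAbove_abs_sub p q) ⟨S, hS⟩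

lemma tv_le {p q : Distr ν} {c : ℝ}
    (h : ∀ S, MeasurableSet S → |p.toMeasure.real S - q.toMeasure.real S| ≤ c) : p.tv q ≤ c :=
  have : Nonempty {S : Set X // MeasurableSet S} := ⟨⟨∅, .empty⟩⟩
  ciSup_le fun S => h S.1 S.2

lemma tv_le_one (p q : Distr ν) : p.tv q ≤ 1 :=
  tv_le fun S _ => abs_real_sub_le_one p q S

lemma tv_comm (p q : Distr ν) : p.tv q = q.tv p := by
  simp only [tv, abs_sub_comm]

lemma tv_triangle (p q r : Distr ν) : p.tv r ≤ p.tv q + q.tv r :=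
  tv_le fun _ hS => (abs_sub_le _ _ _).trans
    (add_le_add (abs_real_sub_le_tv p q hS) (abs_real_sub_le_tv q r hS))

end Basic

section Scheffe

variable {X : Type*} [MeasurableSpace X] {ν : Measure X}

/-- The kernel sending a pair of distributions to its first member. -/
noncomputable def fstKernel (ν : Measure X) : Kernel (Distr ν × Distr ν) X where
  toFun p := p.1.toMeasure
  measurable' := measurable_toMeasure.comp measurable_fst

/-- The kernel sending a pair of distributions to its second member. -/
noncomputable def sndKernel (ν : Measure X) : Kernel (Distr ν × Distr ν) X where
  toFun p := p.2.toMeasure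
  measurable' := measurable_toMeasure.comp measurable_snd

/-- The kernel sending a pair of distributions to the sum of its members. -/
noncomputable def sumKernel (ν : Measure X) : Kernel (Distr ν × Distr ν) X :=
  fstKernel ν + sndKernel ν

lemma fstKernel_apply (p q : Distr ν) : fstKernel ν (p, q) = p.toMeasure := rfl

lemma sumKernel_apply (p q : Distr ν) :
    sumKernel ν (p, q) = p.toMeasure + q.toMeasure := rfl

instance : IsFiniteKernel (fstKernel ν) :=
  ⟨⟨1, ENNReal.one_lt_top, fun p => (measure_univ (μ := p.1.toMeasure)).le⟩⟩

instance : IsFiniteKernel (sndKernel ν) :=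
  ⟨⟨1, ENNReal.one_lt_top, fun p => (measure_univ (μ := p.2.toMeasure)).le⟩⟩

instance : IsFiniteKernel (sumKernel ν) :=
  inferInstanceAs (IsFiniteKernel (fstKernel ν + sndKernel ν))

variable [MeasurableSpace.CountablyGenerated X]

/-- The graph of the Scheffé sets: its section over `(p, q)` is `{x | dp/d(p + q) x > 1/2}`, a set
on which `p` dominates `q` and off which `q` dominates `p`.  Defining it through the Radon–Nikodym
derivative of kernels makes it measurable jointly in `p`, `q` and the point. -/
def scheffeGraph (ν : Measure X) : Set ((Distr ν × Distr ν) × X) :=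
  {z | 2⁻¹ < (fstKernel ν).rnDeriv (sumKernel ν) z.1 z.2}

/-- The Scheffé set of the pair `(p, q)`. -/
def scheffe (p q : Distr ν) : Set X := Prod.mk (p, q) ⁻¹' scheffeGraph ν

lemma measurableSet_scheffeGraph : MeasurableSet (scheffeGraph ν) :=
  measurableSet_lt measurable_const (Kernel.measurable_rnDeriv _ _)

lemma measurableSet_scheffe (p q : Distr ν) : MeasurableSet (scheffe p q) :=
  measurable_prodMk_left measurableSet_scheffeGraph

lemma setLIntegral_rnDeriv_sumKernel (p q : Distr ν) {B : Set X} (hB : MeasurableSet B) :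
    ∫⁻ x in B, (fstKernel ν).rnDeriv (sumKernel ν) (p, q) x ∂(p.toMeasure + q.toMeasure) =
      p.toMeasure B :=
  Kernel.setLIntegral_rnDeriv (κ := fstKernel ν) (η := sumKernel ν) (a := (p, q))
    (by rw [fstKernel_apply, sumKernel_apply]; exact Measure.le_add_right le_rfl
          |>.absolutelyContinuous) hB

lemma real_le_real_of_subset_scheffe (p q : Distr ν) {B : Set X} (hB : MeasurableSet B)
    (hsub : B ⊆ scheffe p q) : q.toMeasure.real B ≤ p.toMeasure.real B := by
  have h : 2⁻¹ * (p.toMeasure + q.toMeasure) B ≤ p.toMeasure B := by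
    rw [← setLIntegral_rnDeriv_sumKernel p q hB, ← setLIntegral_const]
    exact setLIntegral_mono (Kernel.measurable_rnDeriv_right _ _ _) fun x hx => (hsub hx).le
  have h' := ENNReal.toReal_mono (measure_ne_top _ _) h
  rw [ENNReal.toReal_mul, Measure.add_apply,
    ENNReal.toReal_add (measure_ne_top _ _) (measure_ne_top _ _)] at h'
  simp only [ENNReal.toReal_inv, ENNReal.toReal_ofNat] at h'
  simp only [Measure.real]
  linarith

lemma real_le_real_of_subset_compl_scheffe (p q : Distr ν) {B : Set X} (hB : MeasurableSet B)
    (hsub : B ⊆ (scheffe p q)ᶜ) : p.toMeasure.real B ≤ q.toMeasure.real B := by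
  have h : p.toMeasure B ≤ 2⁻¹ * (p.toMeasure + q.toMeasure) B := by
    conv_lhs => rw [← setLIntegral_rnDeriv_sumKernel p q hB]
    rw [← setLIntegral_const]
    exact setLIntegral_mono measurable_const fun x hx => not_lt.1 (hsub hx)
  have h' := ENNReal.toReal_mono (ENNReal.mul_ne_top (by simp) (measure_ne_top _ _)) h
  rw [ENNReal.toReal_mul, Measure.add_apply,
    ENNReal.toReal_add (measure_ne_top _ _) (measure_ne_top _ _)] at h'
  simp only [ENNReal.toReal_inv, ENNReal.toReal_ofNat] at h'
  simp only [Measure.real]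
  linarith

lemma real_sub_real_le_scheffe (p q : Distr ν) {S : Set X} (hS : MeasurableSet S) :
    p.toMeasure.real S - q.toMeasure.real S ≤
      p.toMeasure.real (scheffe p q) - q.toMeasure.real (scheffe p q) := by
  have hA := measurableSet_scheffe p q
  have hp := measureReal_inter_add_sdiff (μ := p.toMeasure) (s := S) hA
  have hq := measureReal_inter_add_sdiff (μ := q.toMeasure) (s := S) hA
  have hp' := measureReal_inter_add_sdiff (μ := p.toMeasure) (s := scheffe p q) hS
  have hq' := measureReal_inter_add_sdiff (μ := q.toMeasure) (s := scheffe p q) hS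
  have h1 := real_le_real_of_subset_compl_scheffe p q (hS.diff hA) (fun x hx => hx.2)
  have h2 := real_le_real_of_subset_scheffe p q (hA.diff hS) (fun x hx => hx.1)
  rw [Set.inter_comm] at hp' hq'
  linarith

/-- The total variation distance is attained on the Scheffé set. -/
lemma tv_eq_scheffe (p q : Distr ν) :
    p.tv q = p.toMeasure.real (scheffe p q) - q.toMeasure.real (scheffe p q) := by
  refine le_antisymm (tv_le fun S hS => abs_le.2 ⟨?_, real_sub_real_le_scheffe p q hS⟩)
    ((le_abs_self _).trans (abs_real_sub_le_tv p q (measurableSet_scheffe p q)))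
  have h := real_sub_real_le_scheffe p q hS.compl
  rw [probReal_compl_eq_one_sub hS, probReal_compl_eq_one_sub hS] at h
  linarith

lemma measurable_real_fst_scheffe :
    Measurable fun z : Distr ν × Distr ν => z.1.toMeasure.real (scheffe z.1 z.2) :=
  (Kernel.measurable_kernel_prodMk_left (κ := fstKernel ν)
    measurableSet_scheffeGraph).ennreal_toReal

lemma measurable_real_snd_scheffe :
    Measurable fun z : Distr ν × Distr ν => z.2.toMeasure.real (scheffe z.1 z.2) :=
  (Kernel.measurable_kernel_prodMk_left (κ := sndKernel ν)
    measurableSet_scheffeGraph).ennreal_toReal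

lemma measurable_tv : Measurable fun z : Distr ν × Distr ν => z.1.tv z.2 := by
  simp only [tv_eq_scheffe]
  exact measurable_real_fst_scheffe.sub measurable_real_snd_scheffe

lemma measurable_tv_left (f : Distr ν) : Measurable fun g => f.tv g := by
  have h : Measurable fun g : Distr ν => (f, g) := measurable_prodMk_left
  simpa only [Function.comp_def] using measurable_tv.comp h

lemma measurableSet_tv_le (f : Distr ν) (c : ℝ) : MeasurableSet {g : Distr ν | f.tv g ≤ c} :=
  measurableSet_le (measurable_tv_left f) measurable_const

end Scheffe

section Mix

variable {X : Type*} [MeasurableSpace X] {ν : Measure X} {k : ℕ}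

/-- The mixture of the distributions `f i` with weights `w i`. -/
noncomputable def mix (w : stdSimplex ℝ (Fin k)) (f : Fin k → Distr ν) : Distr ν :=
  ⟨∑ i, ENNReal.ofReal (w.1 i) • (f i).toMeasure,
    ⟨by
      simp only [Measure.coe_finsetSum, Finset.sum_apply, Measure.smul_apply, measure_univ,
        smul_eq_mul, mul_one]
      rw [← ENNReal.ofReal_sum_of_nonneg fun i _ => w.2.1 i, w.2.2, ENNReal.ofReal_one]⟩,
    fun s hs => by
      simp only [Measure.coe_finsetSum, Finset.sum_apply, Measure.smul_apply, smul_eq_mul]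
      exact Finset.sum_eq_zero fun i _ => by rw [show (f i).toMeasure s = 0 from (f i).2.2 hs, mul_zero]⟩

lemma toMeasure_mix (w : stdSimplex ℝ (Fin k)) (f : Fin k → Distr ν) :
    (mix w f).toMeasure = ∑ i, ENNReal.ofReal (w.1 i) • (f i).toMeasure := rfl

lemma real_mix (w : stdSimplex ℝ (Fin k)) (f : Fin k → Distr ν) (S : Set X) :
    (mix w f).toMeasure.real S = ∑ i, w.1 i * (f i).toMeasure.real S := by
  rw [toMeasure_mix, Measure.real, Measure.coe_finsetSum, Finset.sum_apply, ENNReal.toReal_sum]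
  · refine Finset.sum_congr rfl fun i _ => ?_
    rw [Measure.smul_apply, smul_eq_mul, ENNReal.toReal_mul, ENNReal.toReal_ofReal (w.2.1 i)]
    rfl
  · exact fun i _ => ENNReal.mul_ne_top ENNReal.ofReal_ne_top (measure_ne_top _ _)

lemma measurable_mix (w : stdSimplex ℝ (Fin k)) :
    Measurable (mix w : (Fin k → Distr ν) → Distr ν) := by
  refine Measurable.subtype_mk (Measure.measurable_of_measurable_coe _ fun s hs => ?_)
  simp only [Measure.coe_finsetSum, Finset.sum_apply, Measure.smul_apply, smul_eq_mul]
  exact Finset.measurable_sum _ fun i _ => ((Measure.measurable_coe hs).comp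
    (measurable_toMeasure.comp (measurable_pi_apply i))).const_mul _

lemma tv_mix_le (w w' : stdSimplex ℝ (Fin k)) (f f' : Fin k → Distr ν) :
    (mix w f).tv (mix w' f') ≤ ∑ i, w.1 i * (f i).tv (f' i) + ∑ i, |w.1 i - w'.1 i| := by
  refine tv_le fun S hS => ?_
  rw [real_mix, real_mix, ← Finset.sum_sub_distrib, ← Finset.sum_add_distrib]
  refine (Finset.abs_sum_le_sum_abs _ _).trans (Finset.sum_le_sum fun i _ => ?_)
  have h0 : 0 ≤ (f' i).toMeasure.real S := measureReal_nonneg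
  have h1 : (f' i).toMeasure.real S ≤ 1 := measureReal_le_one
  calc |w.1 i * (f i).toMeasure.real S - w'.1 i * (f' i).toMeasure.real S|
      = |w.1 i * ((f i).toMeasure.real S - (f' i).toMeasure.real S) +
          (w.1 i - w'.1 i) * (f' i).toMeasure.real S| := by ring_nf
    _ ≤ w.1 i * |(f i).toMeasure.real S - (f' i).toMeasure.real S| +
          |w.1 i - w'.1 i| * (f' i).toMeasure.real S := by
        refine (abs_add_le _ _).trans_eq ?_
        rw [abs_mul, abs_mul, abs_of_nonneg (w.2.1 i), abs_of_nonneg h0]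
    _ ≤ _ := add_le_add
        (mul_le_mul_of_nonneg_left (abs_real_sub_le_tv _ _ hS) (w.2.1 i))
        (mul_le_of_le_one_right (abs_nonneg _) h1)

/-- A mixture is a corruption of each of its components of weight at least `1 - γ`. -/
lemma mix_mem_corrupted (w : stdSimplex ℝ (Fin k)) (f : Fin k → Distr ν) (i : Fin k) {γ : ℝ}
    (hγ : 0 < γ) (hγ1 : γ ≤ 1) (hi : 1 - γ ≤ w.1 i) : mix w f ∈ (f i).corrupted γ := by
  have hnn : ∀ j, 0 ≤ w.1 j - (if j = i then 1 - γ else 0) := fun j => by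
    split_ifs with h
    · subst h; linarith
    · simpa using w.2.1 j
  -- The weights of the corrupting mixture: remove mass `1 - γ` from component `i`, renormalize.
  let w' : stdSimplex ℝ (Fin k) := ⟨fun j => (w.1 j - if j = i then 1 - γ else 0) / γ,
    fun j => div_nonneg (hnn j) hγ.le, by
      rw [← Finset.sum_div, Finset.sum_sub_distrib, w.2.2]
      simp [hγ.ne']⟩
  refine ⟨mix w' f, ?_⟩
  have key : ∀ j, ENNReal.ofReal (w.1 j) • (f j).toMeasure =
      (if j = i then ENNReal.ofReal (1 - γ) • (f i).toMeasure else 0) +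
        ENNReal.ofReal γ • ENNReal.ofReal (w'.1 j) • (f j).toMeasure := fun j => by
    have hw' : γ * w'.1 j = w.1 j - if j = i then 1 - γ else 0 := by
      simp only [w']; field_simp
    rw [smul_smul, ← ENNReal.ofReal_mul hγ.le, hw']
    split_ifs with h
    · subst h
      rw [← add_smul, ← ENNReal.ofReal_add (by linarith) (by linarith)]
      congr 2; ring
    · simp
  rw [toMeasure_mix, toMeasure_mix, Finset.smul_sum, Finset.sum_congr rfl fun j _ => key j,
    Finset.sum_add_distrib]
  simp

end Mix

end Distr

/-! ### Rounding weights to a grid -/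

/-- The weight vectors of length `k` whose entries are multiples of `1 / N`, encoded by their
numerators. -/
abbrev GridWeight (k N : ℕ) : Type :=
  {a : Fin k → Fin (N + 1) // ∑ i, (a i : ℕ) = N}

namespace GridWeight

variable {k N : ℕ}

/-- The point of the simplex encoded by the numerators `a`. -/
noncomputable def toSimplex (hN : 0 < N) (a : GridWeight k N) : stdSimplex ℝ (Fin k) :=
  ⟨fun i => (a.1 i : ℕ) / (N : ℝ), fun i => by positivity, by
    rw [← Finset.sum_div, ← Nat.cast_sum, a.2]
    exact div_self (by positivity)⟩

lemma card_le (k N : ℕ) : Fintype.card (GridWeight k N) ≤ (N + 1) ^ k := by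
  refine (Fintype.card_subtype_le _).trans ?_
  simp

instance subsingleton_one (N : ℕ) : Subsingleton (GridWeight 1 N) := by
  refine ⟨fun a b => Subtype.ext (funext fun i => Fin.ext ?_)⟩
  have ha := a.2
  have hb := b.2
  simp only [Fin.sum_univ_one] at ha hb
  rw [Subsingleton.elim i 0, ha, hb]

/-- Rounding: all weights but one are rounded down, and one absorbs the remainder. -/
lemma exists_sum_abs_sub_le (hN : 0 < N) (w : stdSimplex ℝ (Fin k)) :
    ∃ a : GridWeight k N, ∑ i, |w.1 i - (a.toSimplex hN).1 i| ≤ 2 * k / N := by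
  have hN' : (0 : ℝ) < N := by exact_mod_cast hN
  have hk : Nonempty (Fin k) := by
    by_contra h
    rw [not_nonempty_iff] at h
    have := w.2.2
    simp at this
  obtain ⟨i₀⟩ := hk
  let b : Fin k → ℕ := fun i => ⌊(N : ℝ) * w.1 i⌋₊
  have hnn : ∀ i, 0 ≤ (N : ℝ) * w.1 i := fun i => mul_nonneg hN'.le (w.2.1 i)
  have hb : ∀ i, (b i : ℝ) ≤ N * w.1 i := fun i => Nat.floor_le (hnn i)
  have hb' : ∀ i, (N : ℝ) * w.1 i < b i + 1 := fun i => Nat.lt_floor_add_one _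
  have hbsum : ∑ i, b i ≤ N := by
    have : (∑ i, (b i : ℝ)) ≤ N := by
      refine (Finset.sum_le_sum fun i _ => hb i).trans_eq ?_
      rw [← Finset.mul_sum, w.2.2, mul_one]
    exact_mod_cast this
  let a : Fin k → ℕ := fun i => b i + if i = i₀ then N - ∑ j, b j else 0
  have hasum : ∑ i, a i = N := by
    simp only [a, Finset.sum_add_distrib, Finset.sum_ite_eq', Finset.mem_univ, if_true]
    omega
  have haN : ∀ i, a i < N + 1 := fun i => by
    have : a i ≤ ∑ j, a j := Finset.single_le_sum (fun _ _ => Nat.zero_le _) (Finset.mem_univ i)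
    omega
  refine ⟨⟨fun i => ⟨a i, haN i⟩, hasum⟩, ?_⟩
  simp only [toSimplex]
  -- The remainder equals the total rounding loss, so it at most doubles the error.
  have hrem : ((N - ∑ j, b j : ℕ) : ℝ) ≤ k := by
    rw [Nat.cast_sub hbsum, Nat.cast_sum]
    have h1 : (N : ℝ) = ∑ i, (N : ℝ) * w.1 i := by rw [← Finset.mul_sum, w.2.2, mul_one]
    have h2 : ∑ i, (N : ℝ) * w.1 i ≤ ∑ i, ((b i : ℝ) + 1) :=
      Finset.sum_le_sum fun i _ => (hb' i).le
    rw [Finset.sum_add_distrib] at h2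
    simp at h2
    linarith
  have hterm : ∀ i, |w.1 i - (a i : ℝ) / N| ≤
      1 / N + (if i = i₀ then ((N - ∑ j, b j : ℕ) : ℝ) / N else 0) := fun i => by
    have e : w.1 i - (a i : ℝ) / N =
        (N * w.1 i - b i) / N - (if i = i₀ then ((N - ∑ j, b j : ℕ) : ℝ) / N else 0) := by
      simp only [a]
      split_ifs
      · push_cast; field_simp; ring
      · push_cast; field_simp; ring
    rw [e]
    refine (abs_sub _ _).trans (add_le_add ?_ (le_of_eq (abs_of_nonneg ?_)))
    · rw [abs_of_nonneg (div_nonneg (by linarith [hb i]) hN'.le)]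
      exact div_le_div_of_nonneg_right (by linarith [hb' i]) hN'.le
    · split_ifs <;> positivity
  refine (Finset.sum_le_sum fun i _ => hterm i).trans ?_
  rw [Finset.sum_add_distrib]
  simp only [Finset.sum_const, Finset.card_univ, Fintype.card_fin, Finset.sum_ite_eq',
    Finset.mem_univ, if_true, nsmul_eq_mul]
  rw [mul_one_div, ← add_div]
  exact div_le_div_of_nonneg_right (by linarith) hN'.le

end GridWeight

/-! ### The exponential mechanism -/

section Gibbs

variable {ι : Type*} [Fintype ι]

/-- The Gibbs weights on a finite type for the energies `s`; the exponential mechanism draws an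
index with these probabilities. -/
noncomputable def gibbs (s : ι → ℝ) (i : ι) : ℝ :=
  Real.exp (-s i) / ∑ j, Real.exp (-s j)

lemma gibbs_nonneg (s : ι → ℝ) (i : ι) : 0 ≤ gibbs s i := by
  unfold gibbs; positivity

lemma sum_exp_neg_pos [Nonempty ι] (s : ι → ℝ) : 0 < ∑ j, Real.exp (-s j) :=
  Finset.sum_pos (fun _ _ => Real.exp_pos _) Finset.univ_nonempty

lemma sum_gibbs [Nonempty ι] (s : ι → ℝ) : ∑ i, gibbs s i = 1 := by
  simp only [gibbs, ← Finset.sum_div]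
  exact div_self (sum_exp_neg_pos s).ne'

lemma gibbs_le_exp_mul [Nonempty ι] {s s' : ι → ℝ} {c : ℝ} (h : ∀ i, |s i - s' i| ≤ c) (i : ι) :
    gibbs s i ≤ Real.exp (2 * c) * gibbs s' i := by
  have h1 : Real.exp (-s i) ≤ Real.exp c * Real.exp (-s' i) := by
    rw [← Real.exp_add, Real.exp_le_exp]
    linarith [(abs_le.1 (h i)).1]
  have h2 : ∑ j, Real.exp (-s' j) ≤ Real.exp c * ∑ j, Real.exp (-s j) := by
    rw [Finset.mul_sum]
    refine Finset.sum_le_sum fun j _ => ?_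
    rw [← Real.exp_add, Real.exp_le_exp]
    linarith [(abs_le.1 (h j)).2]
  unfold gibbs
  rw [mul_div_assoc', div_le_div_iff₀ (sum_exp_neg_pos s) (sum_exp_neg_pos s'), two_mul,
    Real.exp_add]
  calc _ ≤ (Real.exp c * Real.exp (-s' i)) * (Real.exp c * ∑ j, Real.exp (-s j)) :=
        mul_le_mul h1 h2 (sum_exp_neg_pos s').le (by positivity)
    _ = _ := by ring

lemma gibbs_le_exp_sub (s : ι → ℝ) (i j : ι) : gibbs s i ≤ Real.exp (s j - s i) := by
  have : Nonempty ι := ⟨i⟩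
  unfold gibbs
  rw [div_le_iff₀ (sum_exp_neg_pos s)]
  calc Real.exp (-s i) = Real.exp (s j - s i) * Real.exp (-s j) := by
        rw [← Real.exp_add]; ring_nf
    _ ≤ _ := mul_le_mul_of_nonneg_left
        (Finset.single_le_sum (f := fun j => Real.exp (-s j)) (fun _ _ => (Real.exp_pos _).le)
          (Finset.mem_univ j)) (Real.exp_pos _).le

end Gibbs

/-! ### Private minimum distance selection -/

namespace Distr

variable {X : Type*} [MeasurableSpace X] {ν : Measure X} {ι : Type*} {r : ℕ}

/-- The number of entries of the dataset `D` in `A`, as a real number. -/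
noncomputable def countIn {X : Type*} (A : Set X) (D : Fin r → X) : ℝ :=
  ∑ t, A.indicator (fun _ => (1 : ℝ)) (D t)

lemma abs_countIn_sub_le {X : Type*} (A : Set X) {D D' : Fin r → X} (h : {t | D t ≠ D' t}.Subsingleton) :
    |countIn A D - countIn A D'| ≤ 1 := by
  have hone : ∀ x y : X,
      |A.indicator (fun _ => (1 : ℝ)) x - A.indicator (fun _ => (1 : ℝ)) y| ≤ 1 := fun x y => by
    by_cases hx : x ∈ A <;> by_cases hy : y ∈ A <;> simp [hx, hy]
  unfold countIn
  rw [← Finset.sum_sub_distrib]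
  rcases h.eq_empty_or_singleton with h0 | ⟨t₀, h0⟩
  · have : ∀ t, D t = D' t := fun t => by
      by_contra hne
      exact (h0 ▸ (show t ∈ {t | D t ≠ D' t} from hne) : t ∈ (∅ : Set (Fin r)))
    simp [this]
  · rw [Finset.sum_eq_single t₀ (fun t _ ht => ?_) (fun h => absurd (Finset.mem_univ _) h)]
    · exact hone _ _
    · have : D t = D' t := by
        by_contra hne
        exact ht (h0 ▸ (show t ∈ {t | D t ≠ D' t} from hne) : t ∈ ({t₀} : Set (Fin r)))
      rw [this, sub_self]

/-- Hoeffding's inequality for the number of samples in a set. -/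
lemma measureReal_lt_abs_countIn_sub_le (g : Distr ν) {A : Set X} (hA : MeasurableSet A)
    (hr : 0 < r) {η : ℝ} (hη : 0 ≤ η) :
    (Measure.pi fun _ : Fin r => g.toMeasure).real
        {D | r * η < |r * g.toMeasure.real A - countIn A D|} ≤
      2 * Real.exp (-2 * r * η ^ 2) := by
  set P := Measure.pi fun _ : Fin r => g.toMeasure
  have hr' : (0 : ℝ) < r := by exact_mod_cast hr
  let φ : X → ℝ := fun x => A.indicator (fun _ => (1 : ℝ)) x - g.toMeasure.real A
  have hφ : Measurable φ := (measurable_const.indicator hA).sub_const _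
  have hsub : HasSubgaussianMGF φ ((‖(1 : ℝ) - 0‖₊ / 2) ^ 2) g.toMeasure := by
    have := hasSubgaussianMGF_of_mem_Icc (μ := g.toMeasure) (a := 0) (b := 1)
      (X := A.indicator fun _ => (1 : ℝ)) (measurable_const.indicator hA).aemeasurable
      (ae_of_all _ fun x => by by_cases hx : x ∈ A <;> simp [hx])
    rwa [show (∫ x, A.indicator (fun _ => (1 : ℝ)) x ∂g.toMeasure) = g.toMeasure.real A from
      integral_indicator_one hA] at this
  have hsub' : ∀ t : Fin r, HasSubgaussianMGF (fun D : Fin r → X => φ (D t))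
      ((‖(1 : ℝ) - 0‖₊ / 2) ^ 2) P := fun t => by
    have hmp := measurePreserving_eval (fun _ : Fin r => g.toMeasure) t
    refine HasSubgaussianMGF.of_map (X := φ) hmp.measurable.aemeasurable ?_
    rw [hmp.map_eq]
    exact hsub
  have hexp : ∀ {Y : Fin r → (Fin r → X) → ℝ}, iIndepFun Y P →
      (∀ t, HasSubgaussianMGF (Y t) ((‖(1 : ℝ) - 0‖₊ / 2) ^ 2) P) →
      P.real {D | r * η ≤ ∑ t, Y t D} ≤ Real.exp (-2 * r * η ^ 2) := fun hY hY' => by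
    refine (HasSubgaussianMGF.measure_sum_ge_le_of_iIndepFun hY (s := Finset.univ)
      (fun t _ => hY' t) (by positivity)).trans_eq ?_
    congr 1
    simp
    field_simp
  have hind : iIndepFun (fun t (D : Fin r → X) => φ (D t)) P :=
    iIndepFun_pi fun _ => hφ.aemeasurable
  have hind' : iIndepFun (fun t (D : Fin r → X) => (-φ) (D t)) P :=
    iIndepFun_pi fun _ => hφ.neg.aemeasurable
  have h1 := hexp hind hsub'
  have h2 := hexp hind' fun t => (hsub' t).neg
  have hsum : ∀ D : Fin r → X, ∑ t, φ (D t) = countIn A D - r * g.toMeasure.real A := fun D => by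
    simp [φ, countIn, Finset.sum_sub_distrib]
  refine (measureReal_mono (fun D hD => ?_) (by finiteness)).trans
    ((measureReal_union_le {D | r * η ≤ ∑ t, φ (D t)}
      {D | r * η ≤ ∑ t, (-φ) (D t)}).trans (by linarith))
  simp only [Set.mem_union, Set.mem_ofPred_eq, Pi.neg_apply, Finset.sum_neg_distrib, hsum] at hD ⊢
  rcases lt_abs.1 hD with h | h
  · right; linarith
  · left; linarith

variable [MeasurableSpace.CountablyGenerated X]

/-- The score of the `i`-th candidate on the dataset `D`: the largest discrepancy, over the Scheffé
sets of the pairs `(H i, H j)`, between the expected number of entries under `H i` and the observed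
number. -/
noncomputable def score (H : ι → Distr ν) (D : Fin r → X) (i : ι) : ℝ :=
  ⨆ j, |r * (H i).toMeasure.real (scheffe (H i) (H j)) - countIn (scheffe (H i) (H j)) D|

lemma le_score [Finite ι] (H : ι → Distr ν) (D : Fin r → X) (i j : ι) :
    |r * (H i).toMeasure.real (scheffe (H i) (H j)) - countIn (scheffe (H i) (H j)) D| ≤
      score H D i :=
  le_ciSup (f := fun j =>
    |r * (H i).toMeasure.real (scheffe (H i) (H j)) - countIn (scheffe (H i) (H j)) D|)
    (Set.finite_range _).bddAbove j

lemma score_le_add_one [Finite ι] [Nonempty ι] (H : ι → Distr ν) {D D' : Fin r → X}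
    (h : {t | D t ≠ D' t}.Subsingleton) (i : ι) : score H D i ≤ score H D' i + 1 := by
  refine ciSup_le fun j => ?_
  have h1 := le_score H D' i j
  have h2 := abs_countIn_sub_le (scheffe (H i) (H j)) h
  rw [abs_le] at *
  constructor <;> linarith

lemma abs_score_sub_le [Finite ι] [Nonempty ι] (H : ι → Distr ν) {D D' : Fin r → X}
    (h : {t | D t ≠ D' t}.Subsingleton) (i : ι) : |score H D i - score H D' i| ≤ 1 := by
  have h' : {t | D' t ≠ D t}.Subsingleton := by simpa only [ne_comm] using h
  have h1 := score_le_add_one H h i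
  have h2 := score_le_add_one H h' i
  exact abs_le.2 ⟨by linarith, by linarith⟩

lemma measurable_score [Countable ι] (i : ι) :
    Measurable fun z : (ι → Distr ν) × (Fin r → X) => score z.1 z.2 i := by
  refine Measurable.iSup fun j => ?_
  have hpair : Measurable fun z : (ι → Distr ν) × (Fin r → X) => (z.1 i, z.1 j) :=
    ((measurable_pi_apply i).comp measurable_fst).prodMk
      ((measurable_pi_apply j).comp measurable_fst)
  have h1 : Measurable fun z : (ι → Distr ν) × (Fin r → X) =>
      (z.1 i).toMeasure.real (scheffe (z.1 i) (z.1 j)) := by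
    simpa only [Function.comp_def] using measurable_real_fst_scheffe.comp hpair
  have h2 : Measurable fun z : (ι → Distr ν) × (Fin r → X) =>
      countIn (scheffe (z.1 i) (z.1 j)) z.2 := by
    refine Finset.measurable_sum _ fun t _ => ?_
    have ht : Measurable fun z : (ι → Distr ν) × (Fin r → X) => ((z.1 i, z.1 j), z.2 t) :=
      hpair.prodMk ((measurable_pi_apply t).comp measurable_snd)
    have hind : Measurable ((scheffeGraph ν).indicator fun _ => (1 : ℝ)) :=
      measurable_const.indicator measurableSet_scheffeGraph
    have := hind.comp ht
    exact this
  have h3 := (h1.const_mul (r : ℝ)).sub h2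
  exact _root_.continuous_abs.measurable.comp h3

/-- The exponential mechanism selecting one of the candidates `H i` with low score on the dataset
`D`; it is a kernel in the pair `(H, D)`. -/
noncomputable def selectKernel [Fintype ι] (ν : Measure X) (ε : ℝ) (r : ℕ) :
    Kernel ((ι → Distr ν) × (Fin r → X)) (Distr ν) where
  toFun z := ∑ i, ENNReal.ofReal (gibbs (fun j => ε / 2 * score z.1 z.2 j) i) •
    Measure.dirac (z.1 i)
  measurable' := by
    refine Measure.measurable_of_measurable_coe _ fun S hS => ?_
    simp only [Measure.coe_finsetSum, Finset.sum_apply, Measure.smul_apply, smul_eq_mul]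
    refine Finset.measurable_sum _ fun i _ => Measurable.mul ?_ ?_
    · refine ENNReal.measurable_ofReal.comp (Measurable.div ?_ ?_)
      · exact Real.measurable_exp.comp ((measurable_score i).const_mul _).neg
      · exact Finset.measurable_sum _ fun j _ =>
          Real.measurable_exp.comp ((measurable_score j).const_mul _).neg
    · have h : Measurable fun z : (ι → Distr ν) × (Fin r → X) => z.1 i :=
        (measurable_pi_apply i).comp measurable_fst
      exact (Measure.measurable_coe hS).comp (Measure.measurable_dirac.comp h)

lemma selectKernel_apply [Fintype ι] (ε : ℝ) (H : ι → Distr ν) (D : Fin r → X)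
    {S : Set (Distr ν)} (hS : MeasurableSet S) :
    selectKernel ν ε r (H, D) S =
      ∑ i, ENNReal.ofReal (gibbs (fun j => ε / 2 * score H D j) i) *
        S.indicator 1 (H i) := by
  change (∑ i, ENNReal.ofReal (gibbs (fun j => ε / 2 * score H D j) i) •
    Measure.dirac (H i)) S = _
  simp only [Measure.coe_finsetSum, Finset.sum_apply, Measure.smul_apply, smul_eq_mul,
    Measure.dirac_apply' _ hS]

instance isMarkovKernel_selectKernel [Fintype ι] [Nonempty ι] (ε : ℝ) :
    IsMarkovKernel (selectKernel (ι := ι) ν ε r) := by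
  refine ⟨fun z => ⟨?_⟩⟩
  rw [← Prod.mk.eta (p := z), selectKernel_apply _ _ _ .univ]
  simp only [Set.indicator_univ, Pi.one_apply, mul_one]
  rw [← ENNReal.ofReal_sum_of_nonneg fun i _ => gibbs_nonneg _ i, sum_gibbs, ENNReal.ofReal_one]

/-- For a fixed list of candidates the selection is `ε`-differentially private. -/
lemma selectKernel_le_exp_mul [Fintype ι] [Nonempty ι] {ε : ℝ} (hε : 0 ≤ ε) (H : ι → Distr ν)
    {D D' : Fin r → X} (h : {t | D t ≠ D' t}.Subsingleton) {S : Set (Distr ν)}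
    (hS : MeasurableSet S) :
    selectKernel ν ε r (H, D) S ≤
      ENNReal.ofReal (Real.exp ε) * selectKernel ν ε r (H, D') S := by
  rw [selectKernel_apply _ _ _ hS, selectKernel_apply _ _ _ hS, Finset.mul_sum]
  refine Finset.sum_le_sum fun i _ => ?_
  rw [← mul_assoc, ← ENNReal.ofReal_mul (Real.exp_pos _).le]
  refine mul_le_mul_left (ENNReal.ofReal_le_ofReal ?_) _
  have := gibbs_le_exp_mul (s := fun j => ε / 2 * score H D j)
    (s' := fun j => ε / 2 * score H D' j) (c := ε / 2) (fun j => by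
      rw [← mul_sub, abs_mul, abs_of_nonneg (by positivity)]
      exact mul_le_of_le_one_right (by positivity) (abs_score_sub_le H h j)) i
  rwa [mul_div_cancel₀ _ (two_ne_zero' ℝ)] at this

/-- If the empirical frequencies of the Scheffé sets are `η`-close to their probabilities under `g`,
then a candidate at distance more than `3 τ + 2 η + ξ` from `g` scores worse by `r ξ` than a
candidate at distance at most `τ`. -/
lemma score_add_le_score [Finite ι] {g : Distr ν} {H : ι → Distr ν} {D : Fin r → X} {τ η ξ : ℝ}
    (hD : ∀ i j, |r * g.toMeasure.real (scheffe (H i) (H j)) - countIn (scheffe (H i) (H j)) D| ≤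
      r * η) {i₀ i : ι} (hi₀ : g.tv (H i₀) ≤ τ) (hi : 3 * τ + 2 * η + ξ < g.tv (H i)) :
    score H D i₀ + r * ξ ≤ score H D i := by
  have : Nonempty ι := ⟨i⟩
  have hr : (0 : ℝ) ≤ r := Nat.cast_nonneg r
  have hclose : ∀ S, MeasurableSet S →
      |r * g.toMeasure.real S - r * (H i₀).toMeasure.real S| ≤ r * τ := fun S hS => by
    rw [← mul_sub, abs_mul, abs_of_nonneg hr]
    exact mul_le_mul_of_nonneg_left ((abs_real_sub_le_tv _ _ hS).trans hi₀) hr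
  have h0 : score H D i₀ ≤ r * (τ + η) := by
    refine ciSup_le fun j => ?_
    have h1 := hclose _ (measurableSet_scheffe (H i₀) (H j))
    have h2 := hD i₀ j
    rw [abs_le] at *
    constructor <;> linarith
  have h1 := le_score H D i i₀
  have h2 := hD i i₀
  have h3 := hclose _ (measurableSet_scheffe (H i) (H i₀))
  have h4 : 2 * τ + 2 * η + ξ ≤ (H i).tv (H i₀) := by
    have := tv_triangle g (H i₀) (H i)
    rw [tv_comm (H i₀)] at this
    linarith
  rw [tv_eq_scheffe] at h4
  have h5 := mul_le_mul_of_nonneg_left h4 hr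
  rw [mul_sub] at h5
  rw [abs_le] at *
  linarith

/-- Accuracy of the selection: the first term of the bound is the failure probability of the
empirical estimates, the second that of the exponential mechanism. -/
lemma lintegral_selectKernel_le [Fintype ι] {ε : ℝ} (hε : 0 ≤ ε) (hr : 0 < r)
    {g : Distr ν} {H : ι → Distr ν} {τ η ξ : ℝ} (hη : 0 ≤ η) {i₀ : ι}
    (hi₀ : g.tv (H i₀) ≤ τ) :
    ∫⁻ D, selectKernel ν ε r (H, D) {p | g.tv p ≤ 3 * τ + 2 * η + ξ}ᶜ
        ∂(Measure.pi fun _ : Fin r => g.toMeasure) ≤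
      ENNReal.ofReal (Fintype.card ι ^ 2 * (2 * Real.exp (-2 * r * η ^ 2)) +
        Fintype.card ι * Real.exp (-(ε / 2 * (r * ξ)))) := by
  have : Nonempty ι := ⟨i₀⟩
  set P := Measure.pi fun _ : Fin r => g.toMeasure
  set bad : Set (Distr ν) := {p | g.tv p ≤ 3 * τ + 2 * η + ξ}ᶜ
  have hbad : MeasurableSet bad := (measurableSet_tv_le _ _).compl
  let E : ι × ι → Set (Fin r → X) := fun ij =>
    {D | r * η < |r * g.toMeasure.real (scheffe (H ij.1) (H ij.2)) -
      countIn (scheffe (H ij.1) (H ij.2)) D|}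
  have hE : ∀ ij, MeasurableSet (E ij) := fun ij => by
    refine measurableSet_lt measurable_const (_root_.continuous_abs.measurable.comp
      (Measurable.const_sub (Finset.measurable_sum _ fun t _ => ?_) _))
    exact (measurable_const.indicator (measurableSet_scheffe _ _)).comp (measurable_pi_apply t)
  have hpt : ∀ D, selectKernel ν ε r (H, D) bad ≤
      ENNReal.ofReal (Fintype.card ι * Real.exp (-(ε / 2 * (r * ξ)))) +
        (⋃ ij, E ij).indicator 1 D := fun D => by
    by_cases hD : D ∈ ⋃ ij, E ij
    · rw [Set.indicator_of_mem hD]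
      exact prob_le_one.trans le_add_self
    · rw [Set.indicator_of_notMem hD, add_zero, selectKernel_apply _ _ _ hbad]
      have hD' : ∀ i j, |r * g.toMeasure.real (scheffe (H i) (H j)) -
          countIn (scheffe (H i) (H j)) D| ≤ r * η := fun i j => by
        by_contra h
        exact hD (Set.mem_iUnion.2 ⟨(i, j), not_le.1 h⟩)
      have : (Fintype.card ι : ℝ) * Real.exp (-(ε / 2 * (r * ξ))) =
          ∑ _i : ι, Real.exp (-(ε / 2 * (r * ξ))) := by simp
      rw [this, ENNReal.ofReal_sum_of_nonneg fun _ _ => (Real.exp_pos _).le]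
      refine Finset.sum_le_sum fun i _ => ?_
      by_cases hi : H i ∈ bad
      · rw [Set.indicator_of_mem hi, Pi.one_apply, mul_one]
        refine ENNReal.ofReal_le_ofReal ((gibbs_le_exp_sub _ i i₀).trans
          (Real.exp_le_exp.2 ?_))
        have := score_add_le_score (ξ := ξ) hD' hi₀ (not_le.1 hi)
        rw [← mul_sub, ← mul_neg]
        exact mul_le_mul_of_nonneg_left (by linarith) (by positivity)
      · simp [Set.indicator_of_notMem hi]
  have hPE : P (⋃ ij, E ij) ≤
      ENNReal.ofReal (Fintype.card ι ^ 2 * (2 * Real.exp (-2 * r * η ^ 2))) := by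
    refine (measure_iUnion_fintype_le P E).trans ?_
    have : (Fintype.card ι : ℝ) ^ 2 * (2 * Real.exp (-2 * r * η ^ 2)) =
        ∑ _ij : ι × ι, 2 * Real.exp (-2 * r * η ^ 2) := by
      simp [Fintype.card_prod, sq]
    rw [this, ENNReal.ofReal_sum_of_nonneg fun _ _ => by positivity]
    refine Finset.sum_le_sum fun ij _ => ?_
    rw [← ofReal_measureReal]
    exact ENNReal.ofReal_le_ofReal
      (measureReal_lt_abs_countIn_sub_le g (measurableSet_scheffe _ _) hr hη)
  refine (lintegral_mono hpt).trans ?_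
  rw [lintegral_add_left measurable_const, lintegral_const, measure_univ, mul_one,
    lintegral_indicator_one (MeasurableSet.iUnion hE), add_comm,
    ENNReal.ofReal_add (by positivity) (by positivity)]
  exact add_le_add_left hPE _

/-- A single candidate is always selected, so selection then cannot fail. -/
lemma selectKernel_compl_eq_zero [Fintype ι] [Subsingleton ι] (ε : ℝ) {g : Distr ν}
    {H : ι → Distr ν} {α : ℝ} {i₀ : ι} (hi₀ : g.tv (H i₀) ≤ α) (D : Fin r → X) :
    selectKernel ν ε r (H, D) {p | g.tv p ≤ α}ᶜ = 0 := by
  rw [selectKernel_apply _ _ _ (measurableSet_tv_le _ _).compl]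
  refine Finset.sum_eq_zero fun i _ => ?_
  rw [Subsingleton.elim i i₀, Set.indicator_of_notMem (by simpa using hi₀), mul_zero]

end Distr

/-! ### Sample size -/

/-- The indices of the candidate mixtures: an entry of a list of length `L` for each of the `k`
components, and a vector of grid weights. -/
abbrev CandIndex (k L N : ℕ) : Type :=
  (Fin k → Fin L) × GridWeight k N

lemma CandIndex.nonempty {k L N : ℕ} (hL : 0 < L) (hk : 0 < k) : Nonempty (CandIndex k L N) :=
  ⟨fun _ => ⟨0, hL⟩, fun i => if i = ⟨0, hk⟩ then Fin.last N else 0, by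
    rw [Finset.sum_eq_single ⟨0, hk⟩] <;> simp +contextual⟩

lemma CandIndex.card_le_exp {k L : ℕ} (hk : 1 ≤ k) (hkL : ¬ (k = 1 ∧ L = 1)) (hL : 1 ≤ L) {α : ℝ}
    (hα : 0 < α) (hα1 : α < 1) :
    (2 : ℝ) ≤ L * k / α ∧
    (Fintype.card (CandIndex k L ⌈36 * k / α⌉₊) : ℝ) ≤
      Real.exp (7 * (k * Real.log (L * k / α))) := by
  have hk' : (1 : ℝ) ≤ k := by exact_mod_cast hk
  have hL' : (1 : ℝ) ≤ L := by exact_mod_cast hL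
  have hLk : (2 : ℝ) ≤ L * k := by
    have : 2 ≤ L * k := by
      rcases Nat.lt_or_ge k 2 with h | h
      · have : 2 ≤ L := by omega
        nlinarith
      · nlinarith
    exact_mod_cast this
  set y : ℝ := L * k / α with hy
  have hy2 : 2 ≤ y := hLk.trans ((le_div_iff₀ hα).2 (by nlinarith))
  refine ⟨hy2, ?_⟩
  have hka : 1 ≤ k / α := (one_le_div hα).2 (by linarith)
  have hN : ((⌈36 * k / α⌉₊ : ℕ) : ℝ) + 1 ≤ 38 * (k / α) := by
    have := Nat.ceil_lt_add_one (a := 36 * (k : ℝ) / α) (by positivity)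
    rw [mul_div_assoc] at this ⊢
    linarith
  have hcard : Fintype.card (CandIndex k L ⌈36 * k / α⌉₊) ≤
      L ^ k * (⌈36 * k / α⌉₊ + 1) ^ k := by
    rw [Fintype.card_prod]
    refine Nat.mul_le_mul (by simp) (GridWeight.card_le _ _)
  calc (Fintype.card (CandIndex k L ⌈36 * k / α⌉₊) : ℝ)
      ≤ L ^ k * (((⌈36 * k / α⌉₊ : ℕ) : ℝ) + 1) ^ k := by exact_mod_cast hcard
    _ ≤ L ^ k * (38 * (k / α)) ^ k := by gcongr
    _ = (38 * y) ^ k := by rw [← mul_pow, hy]; ring_nf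
    _ ≤ (y ^ 7) ^ k := by
        refine pow_le_pow_left₀ (by positivity) ?_ k
        have h6 : (2 : ℝ) ^ 6 ≤ y ^ 6 := pow_le_pow_left₀ (by norm_num) hy2 6
        nlinarith
    _ = Real.exp (7 * (k * Real.log y)) := by
        rw [← pow_mul, ← Real.exp_log (show 0 < y by linarith), ← Real.exp_nat_mul,
          Real.log_exp]
        push_cast; ring_nf

/-- With the stated number `r` of samples, selection among the candidates fails with probability at
most `β / 2`, at deviation `α / 8` of the empirical frequencies and loss `α / 4` of the exponential
mechanism. -/
lemma selection_error_le {k L r : ℕ} (hk : 1 ≤ k) (hL : 1 ≤ L) (hkL : ¬ (k = 1 ∧ L = 1))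
    {α β ε : ℝ} (hα : 0 < α) (hα1 : α < 1) (hβ : 0 < β) (hβ1 : β < 1) (hε : 0 < ε)
    (hr : ⌈544 * ((k * Real.log (L * k / α) + Real.log (1 / β)) *
      (1 / α ^ 2 + 1 / (α * ε)))⌉₊ ≤ r) :
    0 < r ∧
    (Fintype.card (CandIndex k L ⌈36 * k / α⌉₊) : ℝ) ^ 2 * (2 * Real.exp (-2 * r * (α / 8) ^ 2)) +
      (Fintype.card (CandIndex k L ⌈36 * k / α⌉₊) : ℝ) *
        Real.exp (-(ε / 2 * (r * (α / 4)))) ≤ β / 2 := by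
  obtain ⟨hy, hM⟩ := CandIndex.card_le_exp hk hkL hL hα hα1
  set M : ℝ := (Fintype.card (CandIndex k L ⌈36 * k / α⌉₊) : ℝ)
  have hM0 : 0 ≤ M := Nat.cast_nonneg _
  have hk' : (1 : ℝ) ≤ k := by exact_mod_cast hk
  set q : ℝ := k * Real.log (L * k / α) with hq
  set b : ℝ := Real.log (1 / β) with hb
  have hlog : Real.log 2 ≤ Real.log (L * k / α) := Real.log_le_log (by norm_num) hy
  have hlog2 : 0 < Real.log 2 := Real.log_pos (by norm_num)
  have hq2 : Real.log 2 ≤ q := by nlinarith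
  have hb0 : 0 ≤ b := Real.log_nonneg ((one_le_div hβ).2 hβ1.le)
  have hβb : Real.exp (-b) = β := by
    rw [hb, one_div, Real.log_inv, neg_neg, Real.exp_log hβ]
  have hr1 : 544 * ((q + b) * (1 / α ^ 2 + 1 / (α * ε))) ≤ r := Nat.ceil_le.1 hr
  have hQ : 0 < q + b := by linarith
  have hA : 0 < (q + b) * (1 / α ^ 2) := by positivity
  have hB : 0 < (q + b) * (1 / (α * ε)) := by positivity
  rw [mul_add] at hr1
  have hrpos : (0 : ℝ) < r := by linarith
  refine ⟨by exact_mod_cast hrpos, ?_⟩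
  have h1 : 17 * (q + b) ≤ 2 * r * (α / 8) ^ 2 := by
    have : 544 * ((q + b) * (1 / α ^ 2)) * α ^ 2 ≤ r * α ^ 2 :=
      mul_le_mul_of_nonneg_right (by linarith) (by positivity)
    have e : 544 * ((q + b) * (1 / α ^ 2)) * α ^ 2 = 544 * (q + b) := by field_simp
    linarith
  have h2 : 17 * (q + b) ≤ ε / 2 * (r * (α / 4)) := by
    have : 544 * ((q + b) * (1 / (α * ε))) * (α * ε) ≤ r * (α * ε) :=
      mul_le_mul_of_nonneg_right (by linarith) (by positivity)
    have e : 544 * ((q + b) * (1 / (α * ε))) * (α * ε) = 544 * (q + b) := by field_simp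
    linarith
  -- All numerical factors are absorbed into powers of `exp q`, as `q ≥ log 2`.
  have h8 : (8 : ℝ) ≤ Real.exp (3 * q) := by
    calc (8 : ℝ) = Real.exp (3 * Real.log 2) := by
          rw [show (3 : ℝ) = (3 : ℕ) by norm_num, Real.exp_nat_mul, Real.exp_log (by norm_num)]
          norm_num
      _ ≤ _ := Real.exp_le_exp.2 (by linarith)
  have hM1 : M ^ 2 ≤ Real.exp (14 * q) := by
    calc M ^ 2 ≤ Real.exp (7 * q) ^ 2 := pow_le_pow_left₀ hM0 hM 2
      _ = _ := by rw [← Real.exp_nat_mul]; push_cast; ring_nf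
  have hM2 : M ≤ Real.exp (14 * q) := hM.trans (Real.exp_le_exp.2 (by linarith))
  -- Each of the two terms is at most `β / 4`.
  have hterm : ∀ {m t : ℝ}, 0 ≤ m → m ≤ Real.exp (14 * q) → 17 * (q + b) ≤ t →
      8 * (m * Real.exp (-t)) ≤ β := fun {m t} hm0 hm ht => by
    calc 8 * (m * Real.exp (-t))
        ≤ Real.exp (3 * q) * (Real.exp (14 * q) * Real.exp (-(17 * (q + b)))) := by
          gcongr
      _ = Real.exp (-(17 * b)) := by rw [← Real.exp_add, ← Real.exp_add]; ring_nf
      _ ≤ Real.exp (-b) := Real.exp_le_exp.2 (by linarith)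
      _ = β := hβb
  have t1 := hterm (sq_nonneg M) hM1 h1
  have t2 := hterm hM0 hM2 h2
  rw [show -2 * (r : ℝ) * (α / 8) ^ 2 = -(2 * r * (α / 8) ^ 2) by ring]
  linarith

/-! ### Two-stage private algorithms -/

/-- Approximate domination of measures passes from sets to functions with values in `[0, 1]`; this
is the post-processing property of differential privacy. -/
lemma lintegral_le_mul_add_of_measure_le {Ω : Type*} [MeasurableSpace Ω] {μ μ' : Measure Ω}
    {c d : ℝ≥0∞} (hc : c ≠ ∞)
    (h : ∀ S, MeasurableSet S → μ S ≤ c * μ' S + d) {f : Ω → ℝ≥0∞} (hf : Measurable f)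
    (hf1 : ∀ x, f x ≤ 1) : ∫⁻ x, f x ∂μ ≤ c * ∫⁻ x, f x ∂μ' + d := by
  have hfr : ∀ x, f x = ENNReal.ofReal (f x).toReal := fun x =>
    (ENNReal.ofReal_toReal ((hf1 x).trans_lt ENNReal.one_lt_top).ne).symm
  have hlayer : ∀ m : Measure Ω,
      ∫⁻ x, f x ∂m = ∫⁻ t in Set.Ioi (0 : ℝ), m {x | t < (f x).toReal} := fun m => by
    rw [lintegral_congr hfr]
    exact lintegral_eq_lintegral_meas_lt m (ae_of_all _ fun _ => ENNReal.toReal_nonneg)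
      hf.ennreal_toReal.aemeasurable
  rw [hlayer μ, hlayer μ', ← lintegral_const_mul' c _ hc]
  have hpt : ∀ t : ℝ, μ {x | t < (f x).toReal} ≤
      c * μ' {x | t < (f x).toReal} + (Set.Iio (1 : ℝ)).indicator (fun _ => d) t := fun t => by
    by_cases ht : t < 1
    · rw [Set.indicator_of_mem (show t ∈ Set.Iio (1 : ℝ) from ht)]
      exact h _ (measurableSet_lt measurable_const hf.ennreal_toReal)
    · have : {x | t < (f x).toReal} = ∅ := by
        refine Set.eq_empty_of_forall_notMem fun x hx => ht (lt_of_lt_of_le hx ?_)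
        simpa using ENNReal.toReal_mono ENNReal.one_ne_top (hf1 x)
      rw [this]
      simp
  refine (lintegral_mono hpt).trans ?_
  rw [lintegral_add_right _ (measurable_const.indicator measurableSet_Iio),
    lintegral_indicator_const measurableSet_Iio, Measure.restrict_apply measurableSet_Iio]
  refine add_le_add_right ?_ _
  rw [Set.inter_comm, Set.Ioi_inter_Iio, Real.volume_Ioo]
  simp

section TwoStage

variable {X Y Z : Type*} [MeasurableSpace X] [MeasurableSpace Y] [MeasurableSpace Z] {m n : ℕ}

/-- The first `m` entries of a dataset of size `n`. -/
def front {X : Type*} (h : m ≤ n) (D : Fin n → X) : Fin m → X := fun i => D (Fin.castLE h i)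

/-- The last `n - m` entries of a dataset of size `n`. -/
def back {X : Type*} (h : m ≤ n) (D : Fin n → X) : Fin (n - m) → X :=
  fun j => D (Fin.cast (Nat.add_sub_of_le h) (Fin.natAdd m j))

lemma measurable_front (h : m ≤ n) : Measurable (front h : (Fin n → X) → _) :=
  measurable_pi_lambda _ fun _ => measurable_pi_apply _

lemma measurable_back (h : m ≤ n) : Measurable (back h : (Fin n → X) → _) :=
  measurable_pi_lambda _ fun _ => measurable_pi_apply _

/-- Splitting an i.i.d. sample into its front and its back gives two independent i.i.d. samples. -/
lemma measurePreserving_front_back (h : m ≤ n) (μ : Measure X) [IsProbabilityMeasure μ] :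
    MeasurePreserving (fun D : Fin n → X => (front h D, back h D))
      (Measure.pi fun _ => μ) ((Measure.pi fun _ => μ).prod (Measure.pi fun _ => μ)) := by
  let e : Fin m ⊕ Fin (n - m) ≃ Fin n := finSumFinEquiv.trans (finCongr (Nat.add_sub_of_le h))
  have h1 := measurePreserving_piCongrLeft (fun _ : Fin m ⊕ Fin (n - m) => μ) e.symm
  have h2 := measurePreserving_sumPiEquivProdPi (fun _ : Fin m ⊕ Fin (n - m) => μ)
  have h3 := h2.comp h1
  have happ : ∀ (D : Fin n → X) (s : Fin m ⊕ Fin (n - m)),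
      MeasurableEquiv.piCongrLeft (fun _ => X) e.symm D s = D (e s) := fun D s => by
    conv_lhs => rw [← e.symm_apply_apply s]
    rw [MeasurableEquiv.coe_piCongrLeft]
    exact Equiv.piCongrLeft_apply_apply (fun _ => X) e.symm D (e s)
  convert h3 using 1
  funext D
  refine Prod.ext (funext fun i => ?_) (funext fun j => ?_)
  · exact (happ D (Sum.inl i)).symm
  · exact (happ D (Sum.inr j)).symm

lemma front_subsingleton {X : Type*} (h : m ≤ n) {D D' : Fin n → X}
    (hD : {i | D i ≠ D' i}.Subsingleton) :
    {i | front h D i ≠ front h D' i}.Subsingleton := fun _ hi _ hj =>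
  Fin.castLE_injective h (hD hi hj)

lemma back_subsingleton {X : Type*} (h : m ≤ n) {D D' : Fin n → X}
    (hD : {i | D i ≠ D' i}.Subsingleton) :
    {i | back h D i ≠ back h D' i}.Subsingleton := fun _ hi _ hj =>
  Fin.natAdd_injective _ _ (Fin.cast_injective _ (hD hi hj))

/-- Changing one entry of a dataset affects only its front or only its back. -/
lemma front_eq_or_back_eq {X : Type*} (h : m ≤ n) {D D' : Fin n → X}
    (hD : {i | D i ≠ D' i}.Subsingleton) : front h D = front h D' ∨ back h D = back h D' := by
  by_contra! hne
  obtain ⟨i, hi⟩ := Function.ne_iff.1 hne.1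
  obtain ⟨j, hj⟩ := Function.ne_iff.1 hne.2
  have := congrArg Fin.val (hD hi hj)
  simp at this
  omega

/-- Run `κ` on the front of the dataset, and `η` on its result and the back of the dataset. -/
noncomputable def twoStage (h : m ≤ n) (κ : Kernel (Fin m → X) Z)
    (η : Kernel (Z × (Fin (n - m) → X)) Y) : Kernel (Fin n → X) Y :=
  Kernel.snd ((κ.comap (front h) (measurable_front h)) ⊗ₖ
    (η.comap (fun p : (Fin n → X) × Z => (p.2, back h p.1))
      (measurable_snd.prodMk ((measurable_back h).comp measurable_fst))))

instance (h : m ≤ n) (κ : Kernel (Fin m → X) Z) (η : Kernel (Z × (Fin (n - m) → X)) Y)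
    [IsMarkovKernel κ] [IsMarkovKernel η] : IsMarkovKernel (twoStage h κ η) := by
  unfold twoStage; infer_instance

lemma twoStage_apply (h : m ≤ n) (κ : Kernel (Fin m → X) Z)
    (η : Kernel (Z × (Fin (n - m) → X)) Y) [IsMarkovKernel κ] [IsMarkovKernel η] (D : Fin n → X)
    {S : Set Y} (hS : MeasurableSet S) :
    twoStage h κ η D S = ∫⁻ z, η (z, back h D) S ∂κ (front h D) := by
  rw [twoStage, Kernel.snd_apply' _ _ hS, Kernel.compProd_apply (measurable_snd hS)]
  rfl

/-- Since the two stages see disjoint parts of the dataset, privacy does not degrade. -/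
lemma twoStage_le (h : m ≤ n) (κ : Kernel (Fin m → X) Z)
    (η : Kernel (Z × (Fin (n - m) → X)) Y) [IsMarkovKernel κ] [IsMarkovKernel η]
    {c d : ℝ≥0∞} (hc : c ≠ ∞)
    (hκ : ∀ D D' : Fin m → X, {i | D i ≠ D' i}.Subsingleton → ∀ S, MeasurableSet S →
      κ D S ≤ c * κ D' S + d)
    (hη : ∀ z, ∀ D D' : Fin (n - m) → X, {i | D i ≠ D' i}.Subsingleton → ∀ S, MeasurableSet S →
      η (z, D) S ≤ c * η (z, D') S)
    {D D' : Fin n → X} (hD : {i | D i ≠ D' i}.Subsingleton) {S : Set Y} (hS : MeasurableSet S) :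
    twoStage h κ η D S ≤ c * twoStage h κ η D' S + d := by
  rw [twoStage_apply _ _ _ _ hS, twoStage_apply _ _ _ _ hS]
  rcases front_eq_or_back_eq h hD with he | he
  · rw [he, ← lintegral_const_mul' c _ hc]
    exact (lintegral_mono fun z => hη z _ _ (back_subsingleton h hD) S hS).trans le_self_add
  · rw [he]
    exact lintegral_le_mul_add_of_measure_le hc (hκ _ _ (front_subsingleton h hD))
      ((Kernel.measurable_coe η hS).comp measurable_prodMk_right) fun _ => prob_le_one

lemma bind_twoStage_apply (h : m ≤ n) (κ : Kernel (Fin m → X) Z)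
    (η : Kernel (Z × (Fin (n - m) → X)) Y) [IsMarkovKernel κ] [IsMarkovKernel η]
    (μ : Measure X) [IsProbabilityMeasure μ] {S : Set Y} (hS : MeasurableSet S) :
    (Measure.pi fun _ => μ).bind (twoStage h κ η) S =
      ∫⁻ z, ∫⁻ D, η (z, D) S ∂(Measure.pi fun _ => μ) ∂(Measure.pi fun _ => μ).bind κ := by
  have hη : Measurable fun p : Z × (Fin (n - m) → X) => η p S := Kernel.measurable_coe η hS
  have hint : Measurable fun p : (Fin m → X) × (Fin (n - m) → X) =>
      ∫⁻ z, η (z, p.2) S ∂κ p.1 := by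
    have hu : Measurable fun q : ((Fin m → X) × (Fin (n - m) → X)) × Z => η (q.2, q.1.2) S :=
      hη.comp (measurable_snd.prodMk (measurable_snd.comp measurable_fst))
    exact hu.lintegral_kernel_prod_right' (κ := κ.comap Prod.fst measurable_fst)
  rw [Measure.bind_apply hS (Kernel.aemeasurable _)]
  simp only [twoStage_apply _ _ _ _ hS]
  rw [(measurePreserving_front_back h μ).lintegral_comp hint, lintegral_prod _ hint.aemeasurable,
    Measure.lintegral_bind (Kernel.aemeasurable _) hη.lintegral_prod_right'.aemeasurable]
  refine lintegral_congr fun D => ?_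
  exact lintegral_lintegral_swap (μ := Measure.pi fun _ => μ) (ν := κ D)
    (f := fun (D' : Fin (n - m) → X) z => η (z, D') S)
    (hη.comp measurable_swap).aemeasurable

end TwoStage

/-! ### Candidate mixtures from a list -/

namespace DistrList

variable {X : Type*} [MeasurableSpace X] {ν : Measure X}

lemma measurable_of_forall_mk {Y : Type*} [MeasurableSpace Y] {φ : DistrList ν → Y}
    (h : ∀ m, Measurable fun l : Fin m → Distr ν => φ ⟨m, l⟩) : Measurable φ := by
  intro S hS
  refine MeasurableSpace.measurableSet_iInf.2 fun m => ?_
  exact h m hS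

/-- The first `L` entries of a list, filled up with `p₀`. -/
def pad (p₀ : Distr ν) (L : ℕ) (l : DistrList ν) : Fin L → Distr ν :=
  fun j => if h : (j : ℕ) < l.1 then l.2 ⟨j, h⟩ else p₀

lemma measurable_pad (p₀ : Distr ν) (L : ℕ) : Measurable (pad p₀ L) := by
  refine measurable_of_forall_mk fun m => ?_
  refine measurable_pi_lambda _ fun j => ?_
  by_cases h : (j : ℕ) < m
  · simp only [pad, h, dif_pos]
    exact measurable_pi_apply (⟨j, h⟩ : Fin m)
  · simp only [pad, h, dif_neg, not_false_eq_true]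
    exact measurable_const

/-- The candidates obtained from a list: all mixtures of `k` of its entries with weights that are
multiples of `1 / N`. -/
noncomputable def candidates {k N : ℕ} (hN : 0 < N) (p₀ : Distr ν) (L : ℕ) (l : DistrList ν) :
    CandIndex k L N → Distr ν :=
  fun x => Distr.mix (x.2.toSimplex hN) fun i => pad p₀ L l (x.1 i)

lemma measurable_candidates {k N : ℕ} (hN : 0 < N) (p₀ : Distr ν) (L : ℕ) :
    Measurable (candidates (k := k) hN p₀ L : DistrList ν → _) :=
  measurable_pi_lambda _ fun _ => (Distr.measurable_mix _).comp
    (measurable_pi_lambda _ fun _ => (measurable_pi_apply _).comp (measurable_pad p₀ L))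

/-- If the list approximates every component of weight at least `c`, some candidate approximates
the mixture. -/
lemma exists_candidates_tv_le {k N L : ℕ} (hN : 0 < N) (hL : 0 < L) (p₀ : Distr ν)
    (w : stdSimplex ℝ (Fin k)) (f : Fin k → Distr ν) {a c : ℝ} (ha : 0 ≤ a) (hc : 0 ≤ c)
    {l : DistrList ν} (hl : l.1 ≤ L)
    (h : ∀ i, c ≤ w.1 i → ∃ j : Fin l.1, (f i).tv (l.2 j) ≤ a) :
    ∃ x : CandIndex k L N,
      (Distr.mix w f).tv (candidates hN p₀ L l x) ≤ a + k * c + 2 * k / N := by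
  obtain ⟨b, hb⟩ := GridWeight.exists_sum_abs_sub_le hN w
  have hex : ∀ i, ∃ j : Fin L, c ≤ w.1 i → (f i).tv (pad p₀ L l j) ≤ a := fun i => by
    by_cases hi : c ≤ w.1 i
    · obtain ⟨j, hj⟩ := h i hi
      exact ⟨⟨j, j.2.trans_le hl⟩, fun _ => by simpa [pad] using hj⟩
    · exact ⟨⟨0, hL⟩, fun h => absurd h hi⟩
  choose j hj using hex
  refine ⟨(j, b), (Distr.tv_mix_le _ _ _ _).trans (add_le_add ?_ hb)⟩
  have hterm : ∀ i, w.1 i * (f i).tv (pad p₀ L l (j i)) ≤ w.1 i * a + c := fun i => by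
    by_cases hi : c ≤ w.1 i
    · have := mul_le_mul_of_nonneg_left (hj i hi) (w.2.1 i)
      linarith
    · have h1 := mul_le_of_le_one_right (w.2.1 i) ((f i).tv_le_one (pad p₀ L l (j i)))
      have h2 := mul_nonneg (w.2.1 i) ha
      linarith
  refine (Finset.sum_le_sum fun i _ => hterm i).trans_eq ?_
  rw [Finset.sum_add_distrib, ← Finset.sum_mul, w.2.2]
  simp

lemma measurableSet_exists_tv_le [MeasurableSpace.CountablyGenerated X] (f : Distr ν) (a : ℝ) :
    MeasurableSet {l : DistrList ν | ∃ i : Fin l.1, f.tv (l.2 i) ≤ a} := by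
  refine MeasurableSpace.measurableSet_iInf.2 fun m => ?_
  change MeasurableSet {l : Fin m → Distr ν | ∃ i : Fin m, f.tv (l i) ≤ a}
  rw [Set.ofPred_exists]
  refine MeasurableSet.iUnion fun i => ?_
  have h : Measurable fun l : Fin m → Distr ν => l i := measurable_pi_apply i
  exact h (Distr.measurableSet_tv_le f a)

end DistrList

/-! ### The learner for mixtures -/

section Learner

variable {X : Type*} [MeasurableSpace X] {ν : Measure X}

lemma isProbabilityMeasure_outputLaw {Y : Type*} [MeasurableSpace Y] (T : RandAlg X Y) (n : ℕ)
    (g : Measure X) [IsProbabilityMeasure g] : IsProbabilityMeasure (T.outputLaw n g) := by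
  have := T.markov n
  unfold RandAlg.outputLaw
  infer_instance

lemma corrupted_self (f : Distr ν) {γ : ℝ} (hγ : 0 ≤ γ) (hγ1 : γ ≤ 1) : f ∈ f.corrupted γ :=
  ⟨f, by rw [← add_smul, ← ENNReal.ofReal_add (by linarith) hγ]; simp⟩

/-- A list-decodable learner can only succeed if its list may be nonempty. -/
lemma IsListDecodableLearner.one_le {L m : ℝ → ℝ → ℝ → ℕ} {F : Set (Distr ν)}
    {A : ℝ → ℝ → ℝ → RandAlg X (DistrList ν)} (hA : IsListDecodableLearner L m F A)
    (hF : F.Nonempty) {α β γ : ℝ} (hα : α ∈ Set.Ioo (0 : ℝ) 1) (hβ : β ∈ Set.Ioo (0 : ℝ) 1)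
    (hγ : γ ∈ Set.Ioo (0 : ℝ) 1) : 1 ≤ L α β γ := by
  obtain ⟨f, hf⟩ := hF
  obtain ⟨h1, h2⟩ := hA α hα β hβ γ hγ f hf f (corrupted_self f hγ.1.le hγ.2.le) _ le_rfl
  by_contra hL
  refine (lt_of_lt_of_le (ENNReal.ofReal_pos.2 (by linarith [hβ.2])) h2).ne' ?_
  refine measure_mono_null ?_ (ae_iff.1 h1)
  rintro l ⟨i, -⟩
  have := i.pos
  change ¬ l.1 ≤ L α β γ
  omega

variable [MeasurableSpace.CountablyGenerated X]

/-- On samples of a mixture, the list approximates all components of weight at least `1 - γ` except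
with probability `k β`. -/
lemma IsListDecodableLearner.outputLaw_compl_le {L m : ℝ → ℝ → ℝ → ℕ} {F : Set (Distr ν)}
    {A : ℝ → ℝ → ℝ → RandAlg X (DistrList ν)} (hA : IsListDecodableLearner L m F A)
    {α β γ : ℝ} (hα : α ∈ Set.Ioo (0 : ℝ) 1) (hβ : β ∈ Set.Ioo (0 : ℝ) 1)
    (hγ : γ ∈ Set.Ioo (0 : ℝ) 1) {k : ℕ} (w : stdSimplex ℝ (Fin k)) {f : Fin k → Distr ν}
    (hf : ∀ i, f i ∈ F) {n : ℕ} (hn : m α β γ ≤ n) :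
    (A α β γ).outputLaw n (Distr.mix w f).toMeasure
      (⋂ i : {i : Fin k // 1 - γ ≤ w.1 i},
        {l : DistrList ν | ∃ j : Fin l.1, (f i.1).tv (l.2 j) ≤ α})ᶜ ≤ ENNReal.ofReal (k * β) := by
  set M := (A α β γ).outputLaw n (Distr.mix w f).toMeasure
  have : IsProbabilityMeasure M := isProbabilityMeasure_outputLaw _ _ _
  rw [Set.compl_iInter]
  refine (measure_iUnion_fintype_le M _).trans ?_
  have hone : ∀ i : {i : Fin k // 1 - γ ≤ w.1 i},
      M {l : DistrList ν | ∃ j : Fin l.1, (f i.1).tv (l.2 j) ≤ α}ᶜ ≤ ENNReal.ofReal β := fun i => by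
    have h := (hA α hα β hβ γ hγ (f i.1) (hf _) (Distr.mix w f)
      (Distr.mix_mem_corrupted w f i.1 hγ.1 hγ.2.le i.2) n hn).2
    rw [prob_compl_eq_one_sub (DistrList.measurableSet_exists_tv_le _ _), tsub_le_iff_right]
    calc (1 : ℝ≥0∞) = ENNReal.ofReal β + ENNReal.ofReal (1 - β) := by
          rw [← ENNReal.ofReal_add hβ.1.le (by linarith [hβ.2])]; simp
      _ ≤ _ := add_le_add_right h _
  refine (Finset.sum_le_sum fun i _ => hone i).trans ?_
  rw [Finset.sum_const, nsmul_eq_mul, ENNReal.ofReal_mul (Nat.cast_nonneg k),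
    ENNReal.ofReal_natCast]
  gcongr
  exact (Fintype.card_subtype_le _).trans (by simp)

/-- The learner for mixtures: run the list-decodable learner `T` on the first `m` samples, and
select one of the candidate mixtures of its list with the other samples.  Too small datasets are
answered by a fixed distribution. -/
noncomputable def mixtureLearner (T : RandAlg X (DistrList ν)) (m k L N : ℕ) (hN : 0 < N)
    (hL : 0 < L) (hk : 0 < k) (ε : ℝ) (p₀ : Distr ν) : RandAlg X (Distr ν) where
  run n := if h : m ≤ n then
      twoStage h (T.run m)
        ((Distr.selectKernel (ι := CandIndex k L N) ν ε (n - m)).comap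
          (fun p => (DistrList.candidates hN p₀ L p.1, p.2))
          (((DistrList.measurable_candidates hN p₀ L).comp measurable_fst).prodMk measurable_snd))
    else Kernel.const _ (Measure.dirac p₀)
  markov n := by
    have := T.markov m
    have : Nonempty (CandIndex k L N) := CandIndex.nonempty hL hk
    split_ifs <;> infer_instance

lemma isDP_mixtureLearner {T : RandAlg X (DistrList ν)} {ε δ : ℝ} (hT : T.IsDP ε δ) (hε : 0 < ε)
    (m : ℕ) {k L N : ℕ} (hN : 0 < N) (hL : 0 < L) (hk : 0 < k) (p₀ : Distr ν) :
    (mixtureLearner T m k L N hN hL hk ε p₀).IsDP ε δ := by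
  intro n D D' hD S hS
  have := T.markov m
  have : Nonempty (CandIndex k L N) := CandIndex.nonempty hL hk
  by_cases h : m ≤ n
  · simp only [mixtureLearner, dif_pos h]
    exact twoStage_le h _ _ ENNReal.ofReal_ne_top (fun D D' hD S hS => hT m D D' hD S hS)
      (fun z D D' hD S hS => Distr.selectKernel_le_exp_mul hε.le _ hD hS) hD hS
  · simp only [mixtureLearner, dif_neg h, Kernel.const_apply]
    refine le_trans ?_ le_self_add
    refine le_mul_of_one_le_left' ?_
    rw [ENNReal.one_le_ofReal]
    exact Real.one_le_exp hε.le

/-- Selection from a list that approximates the heavy components of a mixture fails with probability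
at most `β / 2`. -/
lemma lintegral_selectKernel_candidates_le {k L r : ℕ} (hk : 1 ≤ k) (hL : 1 ≤ L)
    {α β ε : ℝ} (hα : α ∈ Set.Ioo (0 : ℝ) 1) (hβ : β ∈ Set.Ioo (0 : ℝ) 1) (hε : 0 < ε)
    (hN : 0 < ⌈36 * k / α⌉₊) (p₀ : Distr ν)
    (hr : ⌈544 * ((k * Real.log (L * k / α) + Real.log (1 / β)) *
      (1 / α ^ 2 + 1 / (α * ε)))⌉₊ ≤ r)
    (w : stdSimplex ℝ (Fin k)) (f : Fin k → Distr ν) {l : DistrList ν} (hl : l.1 ≤ L)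
    (h : ∀ i, α / (18 * k) ≤ w.1 i → ∃ j : Fin l.1, (f i).tv (l.2 j) ≤ α / 18) :
    ∫⁻ D, Distr.selectKernel (ι := CandIndex k L ⌈36 * k / α⌉₊) ν ε r
        (DistrList.candidates hN p₀ L l, D) {p | (Distr.mix w f).tv p ≤ α}ᶜ
        ∂(Measure.pi fun _ : Fin r => (Distr.mix w f).toMeasure) ≤ ENNReal.ofReal (β / 2) := by
  have hα0 := hα.1
  have hk' : (0 : ℝ) < k := by exact_mod_cast hk
  obtain ⟨x, hx⟩ := DistrList.exists_candidates_tv_le hN hL p₀ w f (a := α / 18)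
    (c := α / (18 * k)) (by positivity) (by positivity) hl h
  have hround : 2 * (k : ℝ) / ⌈36 * k / α⌉₊ ≤ α / 18 := by
    have hceil := Nat.le_ceil (36 * (k : ℝ) / α)
    rw [div_le_iff₀ hα0] at hceil
    rw [div_le_iff₀ (by exact_mod_cast hN)]
    linarith
  have hτ : (Distr.mix w f).tv (DistrList.candidates hN p₀ L l x) ≤ α / 6 := by
    have : (k : ℝ) * (α / (18 * k)) = α / 18 := by field_simp
    linarith
  by_cases hkL : k = 1 ∧ L = 1
  · -- With one component and one list entry there is a single candidate.  This case has to be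
    -- treated apart, because the sample size then degenerates as `α` and `β` tend to `1`.
    obtain ⟨rfl, rfl⟩ := hkL
    simp only [Distr.selectKernel_compl_eq_zero ε
      (hτ.trans (show α / 6 ≤ α by linarith)), lintegral_zero]
    exact zero_le
  · obtain ⟨hr0, herr⟩ := selection_error_le hk hL hkL hα.1 hα.2 hβ.1 hβ.2 hε hr
    have := Distr.lintegral_selectKernel_le (ξ := α / 4) hε.le hr0
      (show 0 ≤ α / 8 by positivity) hτ
    rw [show 3 * (α / 6) + 2 * (α / 8) + α / 4 = α by ring] at this
    exact this.trans (ENNReal.ofReal_le_ofReal herr)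

/-- On samples of a mixture, the learner fails with probability at most `β`: the list and the
selection contribute `β / 2` each. -/
lemma outputLaw_mixtureLearner_compl_le {L mList : ℝ → ℝ → ℝ → ℕ} {F : Set (Distr ν)}
    {A : ℝ → ℝ → ℝ → RandAlg X (DistrList ν)} (hA : IsListDecodableLearner L mList F A)
    {k : ℕ} (hk : 1 ≤ k) {α β ε : ℝ} (hα : α ∈ Set.Ioo (0 : ℝ) 1) (hβ : β ∈ Set.Ioo (0 : ℝ) 1)
    (hε : 0 < ε) {a b γ : ℝ} (ha : a = α / 18) (hb : b = β / (2 * k)) (hγ : γ = 1 - α / (18 * k))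
    (ha' : a ∈ Set.Ioo (0 : ℝ) 1) (hb' : b ∈ Set.Ioo (0 : ℝ) 1) (hγ' : γ ∈ Set.Ioo (0 : ℝ) 1)
    (hN : 0 < ⌈36 * k / α⌉₊) (hL : 1 ≤ L a b γ) (p₀ : Distr ν)
    (w : stdSimplex ℝ (Fin k)) {f : Fin k → Distr ν} (hf : ∀ i, f i ∈ F) {n : ℕ}
    (hn : mList a b γ + ⌈544 * ((k * Real.log (L a b γ * k / α) + Real.log (1 / β)) *
      (1 / α ^ 2 + 1 / (α * ε)))⌉₊ ≤ n) :
    (mixtureLearner (A a b γ) (mList a b γ) k (L a b γ) ⌈36 * k / α⌉₊ hN hL hk ε p₀).outputLaw n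
      (Distr.mix w f).toMeasure {p | (Distr.mix w f).tv p ≤ α}ᶜ ≤ ENNReal.ofReal β := by
  have hk' : (1 : ℝ) ≤ k := by exact_mod_cast hk
  have hα0 := hα.1
  set g := Distr.mix w f
  set m := mList a b γ
  have h : m ≤ n := by omega
  have := (A a b γ).markov m
  have : Nonempty (CandIndex k (L a b γ) ⌈36 * k / α⌉₊) := CandIndex.nonempty hL hk
  have hγw : 1 - γ = α / (18 * k) := by rw [hγ]; ring
  -- Some component has weight at least `1 / k`, hence the list has at most `L` entries.
  obtain ⟨i₀, hi₀⟩ : ∃ i, 1 - γ ≤ w.1 i := by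
    by_contra! hlt
    have : Nonempty (Fin k) := ⟨⟨0, hk⟩⟩
    have hsum := Finset.sum_lt_sum_of_nonempty Finset.univ_nonempty fun i _ => hlt i
    rw [w.2.2, hγw] at hsum
    simp only [Finset.sum_const, Finset.card_univ, Fintype.card_fin, nsmul_eq_mul] at hsum
    have : (k : ℝ) * (α / (18 * k)) = α / 18 := by field_simp
    linarith [hα.2]
  have hlen := (hA a ha' b hb' γ hγ' (f i₀) (hf _) g
    (Distr.mix_mem_corrupted w f i₀ hγ'.1 hγ'.2.le hi₀) m le_rfl).1
  have hgood := hA.outputLaw_compl_le ha' hb' hγ' w hf (n := m) le_rfl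
  set G : Set (DistrList ν) := ⋂ i : {i : Fin k // 1 - γ ≤ w.1 i},
    {l : DistrList ν | ∃ j : Fin l.1, (f i.1).tv (l.2 j) ≤ a}
  have hG : MeasurableSet G :=
    MeasurableSet.iInter fun i => DistrList.measurableSet_exists_tv_le _ _
  have hM : IsProbabilityMeasure ((A a b γ).outputLaw m g.toMeasure) :=
    isProbabilityMeasure_outputLaw _ _ _
  rw [RandAlg.outputLaw]
  simp only [mixtureLearner, dif_pos h]
  rw [bind_twoStage_apply h _ _ _ (Distr.measurableSet_tv_le _ _).compl]
  calc _ ≤ ∫⁻ l, (ENNReal.ofReal (β / 2) + Gᶜ.indicator 1 l)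
        ∂(A a b γ).outputLaw m g.toMeasure := by
        refine lintegral_mono_ae (hlen.mono fun l hl => ?_)
        by_cases hlG : l ∈ G
        · refine le_trans ?_ le_self_add
          refine lintegral_selectKernel_candidates_le hk hL hα hβ hε hN p₀ (by omega) w f hl
            fun i hi => ?_
          rw [← ha]
          exact Set.mem_iInter.1 hlG ⟨i, by rwa [hγw]⟩
        · rw [Set.indicator_of_mem (show l ∈ Gᶜ from hlG)]
          refine le_trans ?_ le_add_self
          refine (lintegral_mono fun D => prob_le_one).trans ?_
          simp
    _ = ENNReal.ofReal (β / 2) + (A a b γ).outputLaw m g.toMeasure Gᶜ := by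
        rw [lintegral_add_left measurable_const, lintegral_const, measure_univ, mul_one,
          lintegral_indicator_one hG.compl]
    _ ≤ ENNReal.ofReal (β / 2) + ENNReal.ofReal (β / 2) := by
        refine add_le_add_right (hgood.trans_eq ?_) _
        rw [hb]
        congr 1
        field_simp
    _ = ENNReal.ofReal β := by
        rw [← ENNReal.ofReal_add (by linarith [hβ.1]) (by linarith [hβ.1]), add_halves]

end Learner

theorem mainTheorem2 :
    ∃ C : ℝ, 0 < C ∧
      ∀ (X : Type*) [MeasurableSpace X] [MeasurableSpace.CountablyGenerated X]
        (ν : Measure X) (F : Set (Distr ν)), F.Nonempty →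
      ∀ (k : ℕ), 1 ≤ k → ∀ (ε δ : ℝ), 0 < ε → 0 ≤ δ →
      ∀ (L mList : ℝ → ℝ → ℝ → ℕ), HasDPListDecodableLearner ε δ L mList F →
        HasDPPACLearner ε δ
          (fun α β =>
            mList (α / 18) (β / (2 * k)) (1 - α / (18 * k)) +
              ⌈C * ((k * Real.log
                      (L (α / 18) (β / (2 * k)) (1 - α / (18 * k)) * k / α) + Real.log (1 / β)) *
                    (1 / α ^ 2 + 1 / (α * ε)))⌉₊)
          (Distr.kMix k F) := by
  -- `544 = 32 * 17`: deviation `α / 8` in Hoeffding's inequality gives the exponent `r α² / 32`, which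
  -- has to exceed `17` times the logarithmic factor (see `selection_error_le`).
  refine ⟨544, by norm_num, ?_⟩
  intro X _ _ ν F hF k hk ε δ hε _ L mList ⟨A, hA, hDP⟩
  have hk' : (1 : ℝ) ≤ k := by exact_mod_cast hk
  have hk0 : (0 : ℝ) < k := by linarith
  let p₀ := hF.some
  have key : ∀ α β : ℝ, ∃ T : RandAlg X (Distr ν), α ∈ Set.Ioo (0 : ℝ) 1 → β ∈ Set.Ioo (0 : ℝ) 1 →
      T.IsDP ε δ ∧ ∀ g ∈ Distr.kMix k F, ∀ n ≥
        mList (α / 18) (β / (2 * k)) (1 - α / (18 * k)) +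
          ⌈544 * ((k * Real.log
            (L (α / 18) (β / (2 * k)) (1 - α / (18 * k)) * k / α) + Real.log (1 / β)) *
              (1 / α ^ 2 + 1 / (α * ε)))⌉₊,
        ENNReal.ofReal (1 - β) ≤ T.outputLaw n g.toMeasure {fhat | g.tv fhat ≤ α} := by
    intro α β
    by_cases hαβ : α ∈ Set.Ioo (0 : ℝ) 1 ∧ β ∈ Set.Ioo (0 : ℝ) 1
    · obtain ⟨hα, hβ⟩ := hαβ
      have hα0 := hα.1
      have hβ0 := hβ.1
      have ha : α / 18 ∈ Set.Ioo (0 : ℝ) 1 := ⟨by positivity, by linarith [hα.2]⟩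
      have hb : β / (2 * k) ∈ Set.Ioo (0 : ℝ) 1 :=
        ⟨by positivity, (div_lt_one (by positivity)).2 (by linarith [hβ.2])⟩
      have hc : α / (18 * k) < 1 := (div_lt_one (by positivity)).2 (by linarith [hα.2])
      have hc0 : 0 < α / (18 * k) := by positivity
      have hγ : 1 - α / (18 * k) ∈ Set.Ioo (0 : ℝ) 1 := ⟨by linarith, by linarith⟩
      have hN : 0 < ⌈36 * k / α⌉₊ := Nat.ceil_pos.2 (by positivity)
      have hL := hA.one_le hF ha hb hγ
      let T := mixtureLearner (A (α / 18) (β / (2 * k)) (1 - α / (18 * k)))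
        (mList (α / 18) (β / (2 * k)) (1 - α / (18 * k))) k
        (L (α / 18) (β / (2 * k)) (1 - α / (18 * k))) ⌈36 * k / α⌉₊ hN hL hk ε p₀
      refine ⟨T, fun _ _ => ⟨isDP_mixtureLearner (hDP _ ha _ hb _ hγ) hε _ hN hL hk p₀, ?_⟩⟩
      rintro g ⟨w, hw, f, hf, hg⟩ n hn
      obtain rfl : g = Distr.mix ⟨w, hw⟩ f := Subtype.ext hg
      have hbad := outputLaw_mixtureLearner_compl_le hA hk hα hβ hε rfl rfl rfl ha hb hγ hN hL p₀
        ⟨w, hw⟩ hf hn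
      have := isProbabilityMeasure_outputLaw T n (Distr.mix ⟨w, hw⟩ f).toMeasure
      rw [prob_compl_eq_one_sub (Distr.measurableSet_tv_le _ _), tsub_le_iff_left] at hbad
      rw [ENNReal.ofReal_sub _ hβ0.le, ENNReal.ofReal_one, tsub_le_iff_left]
      exact hbad.trans_eq (add_comm _ _)
    · exact ⟨⟨fun _ => Kernel.const _ (Measure.dirac p₀), fun _ => inferInstance⟩,
        fun h1 h2 => absurd ⟨h1, h2⟩ hαβ⟩
  choose T hT using key
  exact ⟨T, fun α hα β hβ g hg n hn => (hT α β hα hβ).2 g hg n hn,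
    fun α hα β hβ => (hT α β hα hβ).1⟩
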